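/- A degree sequence is a polynomial $Q(x)=\sum_{l\ge 2}Q_l x^l$ with non-negative real coefficients, no terms of degree $0$ or $1$, and $Q(1)=1$. Let $(\Lambda,P)$ be a pair of degree sequences, of degrees $l_{\max}$ and $k_{\max}$. A Tanner graph is a bipartite multigraph with variable nodes $[n]$ and finitely many check (function) nodes, all nodes being labelled. Standard ensemble $(n,\Lambda,P)$. It is defined when $m=n\Lambda'(1)/P'(1)$ and all the numbers $n\Lambda_l$, $mP_k$ are integers; call such $n$ admissible. The variable nodes $[n]$ are partitioned uniformly at random into classes $\mathcal V_l$ with $|\mathcal V_l|=n\Lambda_l$, and the check nodes $[m]$ into classes $\mathcal C_k$ with $|\mathcal C_k|=mP_k$. Each node in $\mathcal V_l$ gets $l$ sockets and each node in $\mathcal C_k$ gets $k$ sockets. The $n\Lambda'(1)$ left sockets are matched with the right sockets by a uniformly random bijection, each matched pair giving an edge. Multi-Poisson ensemble $(n,\Lambda,P,\gamma)$. Partition $[n]$ uniformly at random into classes $\mathcal V_l$ with $|\mathcal V_l|=n\Lambda_l$, set $d_i(0)=l$ for $i\in\mathcal V_l$, and start from the graph without check nodes. For each $t=0,\dots,t_{\max}-1$,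 with $t_{\max}=\lfloor\Lambda'(1)/\gamma\rfloor-1$, do the following. If $\sum_j[d_j(t)]_+=0$, the procedure fails. Otherwise, for $2\le k\le k_{\max}$ draw independent Poisson numbers $m^{(t)}_k$ of mean $n\gamma P_k/P'(1)$ and add $m_k^{(t)}$ new check nodes $(\hat a,k,t)$ of degree $k$. Each of them is connected to $k$ variable nodes, all these choices being independent with law $w_i(t)=[d_i(t)]_+/\sum_j[d_j(t)]_+$. Set $d_i(t+1)=d_i(t)-\Delta_i(t)$, where $\Delta_i(t)$ is the number of times that $i$ was chosen in round $t$. Here $[x]_+=\max(x,0)$. A rewiring is the addition or the removal of one check node (with its edges); the names of the check nodes are disregarded when saying that a graph is obtained from another one by rewirings. Lemma. For every pair $(\Lambda,P)$ of degree sequences there are constants $A,b>0$, depending only on $(\Lambda,P)$, such that for every $0<\gamma<1$ there are, for all admissible $n$, couplings $(\mathcal G_{\rm s},\mathcal G_{\rm mP})$ of the standard ensemble $(n,\Lambda,P)$ and the multi-Poisson ensemble $(n,\Lambda,P,\gamma)$ with the following property: with probability tending to $1$ as $n\to\infty$ along the admissible values ($\gamma,\Lambda,P$ being fixed), the multi-Poisson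 procedure does not fail and $\mathcal G_{\rm s}$ is obtained from $\mathcal G_{\rm mP}$ with fewer than $A\,n\,\gamma^{b}$ rewirings. -/

import Mathlib

open Polynomial Finset Filter Topology MeasureTheory ProbabilityTheory
open scoped NNReal ENNReal

noncomputable section

namespace TannerEnsembles

/-! ### Degree sequences -/

/-- A design degree sequence `Q(x) = ∑_{l ≥ 2} Q_l x^l`: a polynomial with non-negative
coefficients, no terms of degree `0` and `1`, and `Q(1) = 1`. -/
structure IsDegreeSequence (Q : ℝ[X]) : Prop where
  nonneg : ∀ l, 0 ≤ Q.coeff l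
  coeff_zero : Q.coeff 0 = 0
  coeff_one : Q.coeff 1 = 0
  eval_one : Q.eval 1 = 1

/-- The average degree `Q'(1)`. -/
def meanDegree (Q : ℝ[X]) : ℝ := (derivative Q).eval 1

/-! ### Tanner graphs and rewirings -/

/-- A Tanner graph with variable nodes `V` and a finite set of check (function) nodes, named by
elements of `L`. Multiple edges are allowed. -/
structure TannerGraph (V L : Type) where
  checks : Finset L
  edges : Multiset (V × L)
  snd_mem : ∀ e ∈ edges, e.2 ∈ checks

/-- The neighborhood of a check node, with multiplicities. -/
def TannerGraph.nbhd {V L : Type} [DecidableEq L] (G : TannerGraph V L) (a : L) : Multiset V :=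
  (G.edges.filter fun e => e.2 = a).map Prod.fst

/-- The function nodes of a Tanner graph, each one given by the variable nodes that it is
connected to. The names of the function nodes are forgotten. -/
def TannerGraph.functionNodes {V L : Type} [DecidableEq L] (G : TannerGraph V L) :
    Multiset (Multiset V) :=
  G.checks.val.map G.nbhd

/-- `Rewires r S T`: the collection `T` of function nodes is obtained from `S` with `r` rewirings,
a rewiring being the addition or the removal of one function node. -/
inductive Rewires {V : Type} : ℕ → Multiset (Multiset V) → Multiset (Multiset V) → Prop
  | refl (S : Multiset (Multiset V)) : Rewires 0 S S
  | add {r : ℕ} {S T : Multiset (Multiset V)} (c : Multiset V) :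
      Rewires r S T → Rewires (r + 1) S (c ::ₘ T)
  | remove {r : ℕ} {S T : Multiset (Multiset V)} (c : Multiset V) :
      Rewires r S (c ::ₘ T) → Rewires (r + 1) S T

/-! ### Partitions of the nodes into degree classes -/

/-- A partition of `N` labelled nodes into classes indexed by the degrees `l = 2, …, l_max`, the
class of `l` having `N Q_l` elements. It is given by the function sending a node to its degree. -/
def NodePartition (N : ℕ) (Q : ℝ[X]) : Type :=
  {d : Fin N → ↥(Finset.Icc 2 Q.natDegree) //
    ∀ l, ((Finset.univ.filter fun i => d i = l).card : ℝ) = N * Q.coeff l}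

/-- The degree of a node. -/
def NodePartition.deg {N : ℕ} {Q : ℝ[X]} (d : NodePartition N Q) (i : Fin N) : ℕ := d.1 i

/-- The sockets: `l` of them at each node of degree `l`. -/
abbrev NodePartition.Socket {N : ℕ} {Q : ℝ[X]} (d : NodePartition N Q) : Type :=
  Σ i : Fin N, Fin (d.deg i)

instance (N : ℕ) (Q : ℝ[X]) : Fintype (NodePartition N Q) := by
  classical
  unfold NodePartition
  infer_instance

/-- All the numbers `N Q_l` are integers. -/
def IntegralClasses (N : ℕ) (Q : ℝ[X]) : Prop := ∀ l, ∃ c : ℕ, (c : ℝ) = N * Q.coeff l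

lemma IsDegreeSequence.sum_Icc {Q : ℝ[X]} (hQ : IsDegreeSequence Q) (f : ℕ → ℝ) :
    ∑ l ∈ Finset.range (Q.natDegree + 1), Q.coeff l * f l =
      ∑ l : ↥(Finset.Icc 2 Q.natDegree), Q.coeff l * f l := by
  rw [Finset.sum_coe_sort (Finset.Icc 2 Q.natDegree) (fun l => Q.coeff l * f l)]
  symm
  apply Finset.sum_subset
  · intro l hl
    simp only [Finset.mem_Icc] at hl
    simp only [Finset.mem_range]
    omega
  · intro l hl hl'
    simp only [Finset.mem_range, Finset.mem_Icc] at hl hl'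
    have : l = 0 ∨ l = 1 := by omega
    rcases this with rfl | rfl
    · simp [hQ.coeff_zero]
    · simp [hQ.coeff_one]

lemma IsDegreeSequence.sum_coeff {Q : ℝ[X]} (hQ : IsDegreeSequence Q) :
    ∑ l : ↥(Finset.Icc 2 Q.natDegree), Q.coeff l = 1 := by
  have h := hQ.sum_Icc (fun _ => 1)
  simp only [mul_one] at h
  rw [← h, ← hQ.eval_one, Polynomial.eval_eq_sum_range]
  simp

lemma IsDegreeSequence.sum_coeff_mul {Q : ℝ[X]} (hQ : IsDegreeSequence Q) :
    ∑ l : ↥(Finset.Icc 2 Q.natDegree), Q.coeff l * (l : ℕ) = meanDegree Q := by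
  rw [← hQ.sum_Icc (fun l => (l : ℝ)), meanDegree, Polynomial.derivative_eval,
    Polynomial.sum_over_range _ (by simp)]
  simp

lemma IsDegreeSequence.nonempty {Q : ℝ[X]} (hQ : IsDegreeSequence Q) {N : ℕ}
    (hN : IntegralClasses N Q) : Nonempty (NodePartition N Q) := by
  classical
  choose c hc using hN
  have hsum : ∑ l : ↥(Finset.Icc 2 Q.natDegree), c l = N := by
    have : ((∑ l : ↥(Finset.Icc 2 Q.natDegree), c l : ℕ) : ℝ) = N := by
      push_cast
      simp only [hc]
      rw [← Finset.mul_sum, hQ.sum_coeff, mul_one]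
    exact_mod_cast this
  have e : (Σ l : ↥(Finset.Icc 2 Q.natDegree), Fin (c l)) ≃ Fin N :=
    Fintype.equivOfCardEq (by rw [Fintype.card_sigma]; simpa only [Fintype.card_fin] using hsum)
  refine ⟨⟨fun i => (e.symm i).1, fun l => ?_⟩⟩
  rw [← hc l]
  congr 1
  rw [← Fintype.card_subtype]
  have e2 : {i : Fin N // (e.symm i).1 = l} ≃ Fin (c l) :=
    (e.symm.subtypeEquiv (q := fun x => x.1 = l) (fun _ => Iff.rfl)).trans
      (Equiv.sigmaSubtype l)
  rw [Fintype.card_congr e2, Fintype.card_fin]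

lemma NodePartition.card_socket {Q : ℝ[X]} (hQ : IsDegreeSequence Q) {N : ℕ}
    (d : NodePartition N Q) : (Fintype.card d.Socket : ℝ) = N * meanDegree Q := by
  classical
  have h1 : ∑ i : Fin N, (d.deg i : ℝ) = ∑ l : ↥(Finset.Icc 2 Q.natDegree),
      ∑ i ∈ Finset.univ.filter (fun i => d.1 i = l), (d.deg i : ℝ) :=
    (Finset.sum_fiberwise _ _ _).symm
  have h2 : ∀ l : ↥(Finset.Icc 2 Q.natDegree),
      ∑ i ∈ Finset.univ.filter (fun i => d.1 i = l), (d.deg i : ℝ)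
        = N * (Q.coeff l * (l : ℕ)) := by
    intro l
    rw [Finset.sum_congr rfl (g := fun _ => ((l : ℕ) : ℝ)), Finset.sum_const, nsmul_eq_mul]
    · rw [show ((Finset.univ.filter (fun i => d.1 i = l)).card : ℝ) = N * Q.coeff l from d.2 l]
      ring
    · intro i hi
      simp only [Finset.mem_filter] at hi
      simp [NodePartition.deg, hi.2]
  rw [Fintype.card_sigma]
  simp only [Fintype.card_fin]
  push_cast
  rw [h1, Finset.sum_congr rfl (fun l _ => h2 l), ← Finset.mul_sum, hQ.sum_coeff_mul]

/-! ### The standard ensemble -/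

/-- The number `m = n Λ'(1) / P'(1)` of check nodes; it is only used when this is an integer. -/
def numChecks (n : ℕ) (Λ P : ℝ[X]) : ℕ := ⌊n * meanDegree Λ / meanDegree P⌋₊

/-- The condition for the standard ensemble `(n, Λ, P)` to be non-empty: `m = n Λ'(1) / P'(1)` and
all the numbers `n Λ_l` and `m P_k` are integers. -/
structure Admissible (Λ P : ℝ[X]) (n : ℕ) : Prop where
  numChecks_eq : (numChecks n Λ P : ℝ) = n * meanDegree Λ / meanDegree P
  left : IntegralClasses n Λ
  right : IntegralClasses (numChecks n Λ P) P

lemma IsDegreeSequence.meanDegree_pos {Q : ℝ[X]} (hQ : IsDegreeSequence Q) :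
    0 < meanDegree Q := by
  rw [← hQ.sum_coeff_mul]
  refine lt_of_lt_of_le one_pos ?_
  rw [← hQ.sum_coeff]
  refine Finset.sum_le_sum fun l _ => ?_
  have hl : 2 ≤ (l : ℕ) := (Finset.mem_Icc.1 l.2).1
  have hl' : (1 : ℝ) ≤ (l : ℕ) := by exact_mod_cast le_trans (by norm_num) hl
  nlinarith [hQ.nonneg l]

lemma Admissible.nonempty_equiv {Λ P : ℝ[X]} (hΛ : IsDegreeSequence Λ) (hP : IsDegreeSequence P)
    {n : ℕ} (h : Admissible Λ P n) (d : NodePartition n Λ)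
    (e : NodePartition (numChecks n Λ P) P) : Nonempty (d.Socket ≃ e.Socket) := by
  refine ⟨Fintype.equivOfCardEq ?_⟩
  have : (Fintype.card d.Socket : ℝ) = Fintype.card e.Socket := by
    rw [NodePartition.card_socket hΛ d, NodePartition.card_socket hP e, h.numChecks_eq,
      div_mul_cancel₀ _ hP.meanDegree_pos.ne']
  exact_mod_cast this

/-- The graph obtained by connecting left and right sockets according to `σ`: each pair of
connected sockets forms an edge. -/
def socketGraph {n m : ℕ} {Λ P : ℝ[X]} (d : NodePartition n Λ) (e : NodePartition m P)
    (σ : d.Socket ≃ e.Socket) : TannerGraph (Fin n) (Fin m) where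
  checks := Finset.univ
  edges := (Finset.univ : Finset d.Socket).val.map fun s => (s.1, (σ s).1)
  snd_mem := fun _ _ => Finset.mem_univ _

/-- The standard ensemble `(n, Λ, P)`: uniformly random partitions of the left and of the right
nodes into degree classes, and a uniformly random matching of the left with the right sockets. -/
def standardEnsemble {Λ P : ℝ[X]} (hΛ : IsDegreeSequence Λ) (hP : IsDegreeSequence P)
    {n : ℕ} (h : Admissible Λ P n) : PMF (TannerGraph (Fin n) (Fin (numChecks n Λ P))) := by
  classical
  haveI := hΛ.nonempty h.left
  haveI := hP.nonempty h.right
  exact (PMF.uniformOfFintype (NodePartition n Λ)).bind fun d =>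
    (PMF.uniformOfFintype (NodePartition (numChecks n Λ P) P)).bind fun e =>
      haveI := h.nonempty_equiv hΛ hP d e
      (PMF.uniformOfFintype (d.Socket ≃ e.Socket)).map (socketGraph d e)

/-! ### The multi-Poisson ensemble -/

/-- The law of a finite family of independent discrete random variables with laws `p i`. -/
def productPMF {ι : Type} [Fintype ι] {α : ι → Type} [∀ i, Countable (α i)]
    (p : ∀ i, PMF (α i)) : PMF (∀ i, α i) :=
  ⟨fun x => ∏ i, p i (x i), by
    let _ : ∀ i, MeasurableSpace (α i) := fun _ => ⊤
    have h := (Measure.pi fun i => (p i).toMeasure).toPMF.2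
    convert h using 1
    funext x
    change _ = (Measure.pi fun i => (p i).toMeasure).toPMF x
    rw [Measure.toPMF_apply, Measure.pi_singleton]
    refine Finset.prod_congr rfl fun i _ => ?_
    rw [PMF.toMeasure_apply_singleton _ _ (measurableSet_singleton _)]⟩

/-- The check nodes added in one round, named by `(k, â)` with `2 ≤ k ≤ k_max` and `â` in a set of
`m_k` elements. -/
abbrev RoundCheck (P : ℝ[X]) (m : ↥(Finset.Icc 2 P.natDegree) → ℕ) : Type :=
  Σ k : ↥(Finset.Icc 2 P.natDegree), Fin (m k)

/-- The choices of variable nodes made in one round: a check node of degree `k` chooses `k` of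
them. -/
abbrev RoundChoice (n : ℕ) (P : ℝ[X]) (m : ↥(Finset.Icc 2 P.natDegree) → ℕ) : Type :=
  (a : RoundCheck P m) → Fin a.1 → Fin n

/-- The state of the construction: the current numbers `d_i(t)` of free sockets, which may become
negative, and the current graph. Check nodes are named by `(â, k, t)`. -/
structure State (n : ℕ) where
  free : Fin n → ℤ
  graph : TannerGraph (Fin n) (ℕ × ℕ × ℕ)

/-- The state before the first round. -/
def State.init {n : ℕ} {Λ : ℝ[X]} (d : NodePartition n Λ) : State n where
  free := fun i => d.deg i
  graph := ⟨∅, 0, by simp⟩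

/-- Add the check nodes of round `t` to the graph, and update the numbers of free sockets. -/
def State.update {n : ℕ} {P : ℝ[X]} (s : State n) (t : ℕ)
    (m : ↥(Finset.Icc 2 P.natDegree) → ℕ) (c : RoundChoice n P m) : State n where
  free := fun i => s.free i -
    ((Finset.univ : Finset (Σ a : RoundCheck P m, Fin a.1)).filter
      fun x => c x.1 x.2 = i).card
  graph :=
    { checks := s.graph.checks ∪
        (Finset.univ : Finset (RoundCheck P m)).image fun a => ((a.2 : ℕ), (a.1 : ℕ), t)
      edges := s.graph.edges +
        (Finset.univ : Finset (Σ a : RoundCheck P m, Fin a.1)).val.map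
          fun x => (c x.1 x.2, ((x.1.2 : ℕ), (x.1.1 : ℕ), t))
      snd_mem := by
        intro e he
        rw [Multiset.mem_add] at he
        rw [Finset.mem_union]
        rcases he with he | he
        · exact Or.inl (s.graph.snd_mem e he)
        · obtain ⟨x, -, rfl⟩ := Multiset.mem_map.1 he
          exact Or.inr (Finset.mem_image_of_mem _ (Finset.mem_univ x.1)) }

/-- The weights `[d_i]_+`. -/
def State.weight {n : ℕ} (s : State n) (i : Fin n) : ℝ≥0∞ := ((s.free i).toNat : ℝ≥0∞)

lemma State.tsum_weight_ne_top {n : ℕ} (s : State n) : ∑' i, s.weight i ≠ ∞ := by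
  rw [tsum_fintype]
  exact ENNReal.sum_ne_top.2 fun i _ => ENNReal.natCast_ne_top _

open Classical in
/-- Round `t`. For each `k`, the number `m_k` of new check nodes of degree `k` is Poisson with mean
`n γ P_k / P'(1)`; the variable nodes that they are connected to are independent with law
`w_i = [d_i]_+ / ∑_j [d_j]_+`. If the denominator vanishes, the procedure fails (`none`). -/
def nextState {n : ℕ} (P : ℝ[X]) (γ : ℝ) (t : ℕ) (s : State n) : PMF (Option (State n)) :=
  if h : ∑' i, s.weight i = 0 then PMF.pure none
  else
    (productPMF fun k : ↥(Finset.Icc 2 P.natDegree) =>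
        (poissonMeasure (n * γ * P.coeff k / meanDegree P).toNNReal).toPMF).bind fun m =>
      (productPMF fun a : RoundCheck P m => productPMF fun _ : Fin a.1 =>
        PMF.normalize s.weight h s.tsum_weight_ne_top).map fun c => some (s.update t m c)

/-- The state after `t` rounds. -/
def stateAfter {n : ℕ} {Λ : ℝ[X]} (P : ℝ[X]) (γ : ℝ) (d : NodePartition n Λ) :
    ℕ → PMF (Option (State n))
  | 0 => PMF.pure (some (State.init d))
  | t + 1 => (stateAfter P γ d t).bind fun o =>
      match o with
      | none => PMF.pure none
      | some s => nextState P γ t s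

/-- The number of rounds `t_max = ⌊Λ'(1) / γ⌋ - 1`. -/
def numRounds (Λ : ℝ[X]) (γ : ℝ) : ℕ := ⌊meanDegree Λ / γ⌋₊ - 1

/-- The multi-Poisson ensemble `(n, Λ, P, γ)`; the outcome `none` means that the procedure has
failed. -/
def multiPoissonEnsemble {Λ : ℝ[X]} (hΛ : IsDegreeSequence Λ) (P : ℝ[X]) (γ : ℝ)
    {n : ℕ} (h : IntegralClasses n Λ) :
    PMF (Option (TannerGraph (Fin n) (ℕ × ℕ × ℕ))) :=
  haveI := hΛ.nonempty h
  (PMF.uniformOfFintype (NodePartition n Λ)).bind fun d =>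
    (stateAfter P γ d (numRounds Λ γ)).map (Option.map State.graph)

/-! ### Couplings -/

/-- `π` is a coupling of `μ` and `ν`. -/
def IsCoupling {X Y : Type} (π : PMF (X × Y)) (μ : PMF X) (ν : PMF Y) : Prop :=
  π.map Prod.fst = μ ∧ π.map Prod.snd = ν

/-- The event that the multi-Poisson construction succeeds and that the first graph is obtained
from the multi-Poisson graph with fewer than `B` rewirings. -/
def closeEvent (n m : ℕ) (B : ℝ) :
    Set (TannerGraph (Fin n) (Fin m) × Option (TannerGraph (Fin n) (ℕ × ℕ × ℕ))) :=
  {x | ∃ G, x.2 = some G ∧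
    ∃ r : ℕ, (r : ℝ) < B ∧ Rewires r G.functionNodes x.1.functionNodes}

end TannerEnsembles

end

noncomputable section

namespace TannerEnsembles

/-! ### Couplings with a bound on the expected cost -/

/-! The uniform matching of the standard ensemble can be revealed a few check nodes at a time, and
revealed so it almost looks like the multi-Poisson construction. Given what is already revealed, the
partner of a fresh check socket is a uniformly chosen free variable socket, so it lies at node `i`
with probability proportional to the number of free sockets of `i` (`matchingLaw_map_node`). The
multi-Poisson choices have weights `[d_i]_+` instead. In each round, after drawing the Poisson
numbers, that many fresh check nodes of each degree are taken from the standard graph, and their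
sockets are coupled optimally, one by one, with the multi-Poisson choices.

If `W` choices have differed so far, the two weight vectors are at `ℓ¹` distance at most `2W`. Write
`D = Λ'(1)` and `g = γ(1+η)`, where `η` is the relative deviation allowed for the Poisson numbers. A
round uses at most `ng` sockets, and at least `n(D - gt)` are free before round `t`, so a choice
differs with probability at most `q = min(1, (2W + ng) / (n(D - gt)))`. Hence `3` to the number of
differences in the round has mean at most `(1+2q)^K`, with `K` the number of choices
(`coupledCost_matchingLaw_productPMF`), and more than `3qng` differences are unlikely
(`CoupledCost.tail`).

This gives the deterministic recursion `diffBound` for `W/n`. Its growth factor per round is about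
`1 + 6g/(D - gt)`, so `2W/n + g` grows at most like `(D - gt)^{-6}`. Stopping this estimate when `D
- gt` falls to `g^{1/7}`, and using `q ≤ 1` from there on, gives `W/n = O(g^{1/7})`
(`diffBound_le`).

A check node without differences is the same in both graphs. The unrevealed check nodes number
`O(nγ)` because the last round stops that close to exhaustion (`RoundInv.mem_closeEvent`). For fixed
`γ` there are boundedly many rounds, each failing with probability `O(1/n)`; `coupledCost_runFrom`
adds these up. -/

lemma PMF.tsum_bind_mul {X Y : Type} (p : PMF X) (f : X → PMF Y) (φ : Y → ℝ≥0∞) :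
    ∑' y, p.bind f y * φ y = ∑' x, p x * ∑' y, f x y * φ y := by
  simp only [PMF.bind_apply, ← ENNReal.tsum_mul_right, ← ENNReal.tsum_mul_left]
  rw [ENNReal.tsum_comm]
  simp only [mul_assoc]

lemma PMF.tsum_map_mul {X Y : Type} (p : PMF X) (f : X → Y) (φ : Y → ℝ≥0∞) :
    ∑' y, p.map f y * φ y = ∑' x, p x * φ (f x) := by
  rw [PMF.map, PMF.tsum_bind_mul]
  refine tsum_congr fun x => ?_
  rw [tsum_eq_single (f x)]
  · simp
  · intro y hy
    simp [hy]

/-- The product coupling. -/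
lemma exists_isCoupling {X Y : Type} (μ : PMF X) (ν : PMF Y) :
    ∃ π : PMF (X × Y), IsCoupling π μ ν := by
  refine ⟨μ.bind fun x => ν.map fun y => (x, y), ?_, ?_⟩
  · rw [PMF.map_bind]
    simp only [PMF.map_comp]
    have : ∀ x : X, PMF.map (Prod.fst ∘ fun y : Y => (x, y)) ν = PMF.pure x :=
      fun x => PMF.map_const ν x
    simp only [this, PMF.bind_pure]
  · rw [PMF.map_bind]
    simp only [PMF.map_comp]
    have : ∀ x : X, PMF.map (Prod.snd ∘ fun y : Y => (x, y)) ν = ν := fun x => PMF.map_id ν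
    simp only [this, PMF.bind_const]

/-- There is a coupling of `μ` and `ν` for which the cost `φ` has expectation at most `c`. -/
def CoupledCost {X Y : Type} (μ : PMF X) (ν : PMF Y) (φ : X × Y → ℝ≥0∞) (c : ℝ≥0∞) : Prop :=
  ∃ π : PMF (X × Y), IsCoupling π μ ν ∧ ∑' z, π z * φ z ≤ c

lemma IsCoupling.fst_mem {X Y : Type} {π : PMF (X × Y)} {μ : PMF X} {ν : PMF Y}
    (h : IsCoupling π μ ν) {z : X × Y} (hz : z ∈ π.support) : z.1 ∈ μ.support := by
  rw [← h.1, PMF.mem_support_map_iff]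
  exact ⟨z, hz, rfl⟩

lemma IsCoupling.snd_mem {X Y : Type} {π : PMF (X × Y)} {μ : PMF X} {ν : PMF Y}
    (h : IsCoupling π μ ν) {z : X × Y} (hz : z ∈ π.support) : z.2 ∈ ν.support := by
  rw [← h.2, PMF.mem_support_map_iff]
  exact ⟨z, hz, rfl⟩

lemma PMF.tsum_mul_le_tsum_mul {X : Type} (p : PMF X) {φ ψ : X → ℝ≥0∞}
    (h : ∀ x ∈ p.support, φ x ≤ ψ x) : ∑' x, p x * φ x ≤ ∑' x, p x * ψ x := by
  refine ENNReal.tsum_le_tsum fun x => ?_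
  by_cases hx : p x = 0
  · simp [hx]
  · exact mul_le_mul_right (h x hx) _

lemma CoupledCost.mono {X Y : Type} {μ : PMF X} {ν : PMF Y} {φ ψ : X × Y → ℝ≥0∞} {c c' : ℝ≥0∞}
    (h : CoupledCost μ ν φ c) (hψ : ∀ x ∈ μ.support, ∀ y ∈ ν.support, ψ (x, y) ≤ φ (x, y))
    (hc : c ≤ c') : CoupledCost μ ν ψ c' := by
  obtain ⟨π, hπ, hle⟩ := h
  refine ⟨π, hπ, le_trans (PMF.tsum_mul_le_tsum_mul π fun z hz => ?_) (hle.trans hc)⟩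
  exact hψ _ (hπ.fst_mem hz) _ (hπ.snd_mem hz)

lemma CoupledCost.mono_right {X Y : Type} {μ : PMF X} {ν : PMF Y} {φ : X × Y → ℝ≥0∞}
    {c c' : ℝ≥0∞} (h : CoupledCost μ ν φ c) (hc : c ≤ c') : CoupledCost μ ν φ c' :=
  h.mono (fun _ _ _ _ => le_rfl) hc

lemma coupledCost_of_le {X Y : Type} (μ : PMF X) (ν : PMF Y) {φ : X × Y → ℝ≥0∞} {c : ℝ≥0∞}
    (h : ∀ x ∈ μ.support, ∀ y ∈ ν.support, φ (x, y) ≤ c) : CoupledCost μ ν φ c := by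
  obtain ⟨π, hπ⟩ := exists_isCoupling μ ν
  refine ⟨π, hπ, le_trans (PMF.tsum_mul_le_tsum_mul π (ψ := fun _ => c) fun z hz => ?_) ?_⟩
  · exact h _ (hπ.fst_mem hz) _ (hπ.snd_mem hz)
  · rw [ENNReal.tsum_mul_right, PMF.tsum_coe, one_mul]

lemma CoupledCost.affine {X Y : Type} {μ : PMF X} {ν : PMF Y} {φ : X × Y → ℝ≥0∞} {c : ℝ≥0∞}
    (h : CoupledCost μ ν φ c) (a b : ℝ≥0∞) :
    CoupledCost μ ν (fun z => a + b * φ z) (a + b * c) := by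
  obtain ⟨π, hπ, hle⟩ := h
  refine ⟨π, hπ, ?_⟩
  simp only [mul_add, ENNReal.tsum_add, ENNReal.tsum_mul_right, PMF.tsum_coe, one_mul]
  have : ∀ z, π z * (b * φ z) = b * (π z * φ z) := fun z => by ring
  simp only [this, ENNReal.tsum_mul_left]
  gcongr

/-- Couplings are glued by running a second-stage coupling on the pair produced by the first. The
first-stage cost serves as the conditional bound for the second stage, so bounds that depend on the
outcome are averaged. -/
lemma CoupledCost.bind {X Y X' Y' : Type} {μ : PMF X} {ν : PMF Y} {φ : X × Y → ℝ≥0∞} {c : ℝ≥0∞}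
    (h : CoupledCost μ ν φ c) {f : X → PMF X'} {g : Y → PMF Y'} {ψ : X' × Y' → ℝ≥0∞}
    (hfg : ∀ x ∈ μ.support, ∀ y ∈ ν.support, CoupledCost (f x) (g y) ψ (φ (x, y))) :
    CoupledCost (μ.bind f) (ν.bind g) ψ c := by
  classical
  obtain ⟨π, hπ, hle⟩ := h
  -- Off the support of `π` an arbitrary coupling is chosen, only to make `κ` total.
  have key : ∀ z : X × Y, ∃ κ : PMF (X' × Y'), IsCoupling κ (f z.1) (g z.2) ∧
      (z ∈ π.support → ∑' w, κ w * ψ w ≤ φ z) := by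
    intro z
    by_cases hz : z ∈ π.support
    · obtain ⟨κ, h1, h2⟩ := hfg _ (hπ.fst_mem hz) _ (hπ.snd_mem hz)
      exact ⟨κ, h1, fun _ => h2⟩
    · obtain ⟨κ, h1⟩ := exists_isCoupling (f z.1) (g z.2)
      exact ⟨κ, h1, fun h => absurd h hz⟩
  choose κ h1 h2 using key
  refine ⟨π.bind κ, ⟨?_, ?_⟩, ?_⟩
  · rw [PMF.map_bind]
    simp only [(h1 _).1]
    rw [← hπ.1, PMF.bind_map]
    rfl
  · rw [PMF.map_bind]
    simp only [(h1 _).2]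
    rw [← hπ.2, PMF.bind_map]
    rfl
  · rw [PMF.tsum_bind_mul]
    exact (PMF.tsum_mul_le_tsum_mul π fun z hz => h2 z hz).trans hle

lemma CoupledCost.map {X Y X' Y' : Type} {μ : PMF X} {ν : PMF Y} {f : X → X'} {g : Y → Y'}
    {φ : X' × Y' → ℝ≥0∞} {c : ℝ≥0∞} (h : CoupledCost μ ν (fun z => φ (f z.1, g z.2)) c) :
    CoupledCost (μ.map f) (ν.map g) φ c := by
  refine CoupledCost.bind h fun x _ y _ => coupledCost_of_le _ _ fun x' hx' y' hy' => ?_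
  simp only [Function.comp_apply, PMF.mem_support_pure_iff] at hx' hy'
  rw [hx', hy']

/-- Two processes that begin with the same random choice. -/
lemma coupledCost_bind_same {X X' Y' : Type} (μ : PMF X) {f : X → PMF X'} {g : X → PMF Y'}
    {ψ : X' × Y' → ℝ≥0∞} {φ : X → ℝ≥0∞}
    (hfg : ∀ x ∈ μ.support, CoupledCost (f x) (g x) ψ (φ x)) :
    CoupledCost (μ.bind f) (μ.bind g) ψ (∑' x, μ x * φ x) := by
  classical
  have key : ∀ x : X, ∃ κ : PMF (X' × Y'), IsCoupling κ (f x) (g x) ∧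
      (x ∈ μ.support → ∑' w, κ w * ψ w ≤ φ x) := by
    intro x
    by_cases hx : x ∈ μ.support
    · obtain ⟨κ, h1, h2⟩ := hfg x hx
      exact ⟨κ, h1, fun _ => h2⟩
    · obtain ⟨κ, h1⟩ := exists_isCoupling (f x) (g x)
      exact ⟨κ, h1, fun h => absurd h hx⟩
  choose κ h1 h2 using key
  refine ⟨μ.bind κ, ⟨?_, ?_⟩, ?_⟩
  · rw [PMF.map_bind]
    simp only [(h1 _).1]
  · rw [PMF.map_bind]
    simp only [(h1 _).2]
  · rw [PMF.tsum_bind_mul]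
    exact PMF.tsum_mul_le_tsum_mul μ fun z hz => h2 z hz

/-- A transport kernel from `ν` to `w` moving as little mass as possible. -/
lemma PMF.exists_transport {V : Type} [Fintype V] [DecidableEq V] (ν w : PMF V) :
    ∃ κ : V → PMF V, ν.bind κ = w ∧
      ∑ u, ν u * (∑ v, κ u v * if u = v then 0 else 1) ≤ ∑ v, (ν v - w v) := by
  set d := ∑ v, (ν v - w v) with hd
  have hν : ∑ v, ν v = 1 := by rw [← tsum_fintype (L := .unconditional V), PMF.tsum_coe]
  have hw : ∑ v, w v = 1 := by rw [← tsum_fintype (L := .unconditional V), PMF.tsum_coe]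
  have hd1 : d ≤ 1 := by
    rw [← hν]
    exact Finset.sum_le_sum fun v _ => tsub_le_self
  have hdtop : d ≠ ∞ := ne_top_of_le_ne_top ENNReal.one_ne_top hd1
  have hd' : d = ∑ v, (w v - ν v) := by
    have h1 : ∑ v, (ν v + (w v - ν v)) = ∑ v, (w v + (ν v - w v)) := by
      refine Finset.sum_congr rfl fun v _ => ?_
      rw [add_tsub_eq_max, add_tsub_eq_max, max_comm]
    rw [Finset.sum_add_distrib, Finset.sum_add_distrib, hν, hw] at h1
    exact ((ENNReal.add_right_inj ENNReal.one_ne_top).1 h1).symm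
  -- `d` is both the total surplus and the total deficit. If it vanishes the laws agree and nothing
  -- moves; otherwise division by `d` is legitimate.
  by_cases hd0 : d = 0
  · have hle : ∀ v, ν v = w v := by
      intro v
      have h1 := (Finset.sum_eq_zero_iff.1 (hd.symm.trans hd0)) v (Finset.mem_univ v)
      have h2 := (Finset.sum_eq_zero_iff.1 (hd'.symm.trans hd0)) v (Finset.mem_univ v)
      exact le_antisymm (tsub_eq_zero_iff_le.1 h1) (tsub_eq_zero_iff_le.1 h2)
    refine ⟨PMF.pure, ?_, ?_⟩
    · rw [PMF.bind_pure]
      exact PMF.ext hle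
    · rw [hd0]
      refine le_of_eq (Finset.sum_eq_zero fun u _ => ?_)
      rw [Finset.sum_eq_zero, mul_zero]
      intro v _
      by_cases huv : u = v
      · simp [huv]
      · simp [PMF.pure_apply, Ne.symm huv]
  -- The fraction of the mass at `u` that stays. The rest is redistributed in proportion to the
  -- deficits `w v - ν v`.
  set s : V → ℝ≥0∞ := fun u => min (ν u) (w u) / ν u with hs
  have hs1 : ∀ u, s u ≤ 1 := fun u =>
    (ENNReal.div_le_div_right (min_le_left _ _) _).trans ENNReal.div_self_le_one
  have hνs : ∀ u, ν u * s u = min (ν u) (w u) := by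
    intro u
    by_cases h0 : ν u = 0
    · simp [h0]
    · exact ENNReal.mul_div_cancel h0 (ν.apply_ne_top u)
  have hνs' : ∀ u, ν u * (1 - s u) = ν u - w u := by
    intro u
    rw [ENNReal.mul_sub (fun _ _ => ν.apply_ne_top u), mul_one, hνs]
    rcases le_total (ν u) (w u) with h | h
    · rw [min_eq_left h, tsub_self, tsub_eq_zero_of_le h]
    · rw [min_eq_right h]
  have hρ : ∑ v, (w v - ν v) / d = 1 := by
    simp only [div_eq_mul_inv]
    rw [← Finset.sum_mul, ← hd', ENNReal.mul_inv_cancel hd0 hdtop]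
  let κ : V → PMF V := fun u => PMF.ofFintype
    (fun v => (if u = v then s u else 0) + (1 - s u) * ((w v - ν v) / d)) (by
      rw [Finset.sum_add_distrib, ← Finset.mul_sum, hρ, mul_one]
      simp only [Finset.sum_ite_eq, Finset.mem_univ, if_true]
      exact add_tsub_cancel_of_le (hs1 u))
  have hκ : ∀ u v, κ u v = (if u = v then s u else 0) + (1 - s u) * ((w v - ν v) / d) :=
    fun u v => rfl
  refine ⟨κ, ?_, ?_⟩
  · ext v
    rw [PMF.bind_apply, tsum_fintype]
    simp only [hκ, mul_add, ← mul_assoc, hνs']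
    rw [Finset.sum_add_distrib, ← Finset.sum_mul, ← hd, ENNReal.mul_div_cancel hd0 hdtop]
    simp only [mul_ite, mul_zero, Finset.sum_ite_eq', Finset.mem_univ, if_true, hνs]
    rcases le_total (ν v) (w v) with h | h
    · rw [min_eq_left h, add_tsub_cancel_of_le h]
    · rw [min_eq_right h, tsub_eq_zero_of_le h, add_zero]
  · rw [hd]
    refine Finset.sum_le_sum fun u _ => ?_
    rw [← hνs']
    refine mul_le_mul_right ?_ _
    calc ∑ v, κ u v * (if u = v then 0 else 1)
        ≤ ∑ v, (1 - s u) * ((w v - ν v) / d) := by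
          refine Finset.sum_le_sum fun v _ => ?_
          by_cases huv : u = v
          · simp [huv]
          · simp [hκ, huv]
      _ = 1 - s u := by rw [← Finset.mul_sum, hρ, mul_one]

/-- Only `f x` is transported, but the coupling retains the whole of `x`: later `x` is the full
matching and `f x` the node met by a single socket. -/
lemma coupledCost_ne {V X : Type} [Fintype V] [DecidableEq V] (μ : PMF X) (f : X → V) (w : PMF V) :
    CoupledCost μ w (fun z => if f z.1 = z.2 then 0 else 1) (∑ v, (μ.map f v - w v)) := by
  obtain ⟨κ, h1, h2⟩ := PMF.exists_transport (μ.map f) w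
  refine ⟨μ.bind fun x => (κ (f x)).map fun v => (x, v), ⟨?_, ?_⟩, ?_⟩
  · rw [PMF.map_bind]
    simp only [PMF.map_comp]
    have : ∀ x : X, PMF.map (Prod.fst ∘ fun y : V => (x, y)) (κ (f x)) = PMF.pure x :=
      fun x => PMF.map_const _ x
    simp only [this, PMF.bind_pure]
  · rw [PMF.map_bind]
    simp only [PMF.map_comp]
    have : ∀ x : X, PMF.map (Prod.snd ∘ fun y : V => (x, y)) (κ (f x)) = κ (f x) :=
      fun x => PMF.map_id _
    simp only [this]
    rw [← h1, PMF.bind_map]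
    rfl
  · refine le_trans (le_of_eq ?_) h2
    rw [PMF.tsum_bind_mul]
    simp only [PMF.tsum_map_mul]
    rw [← tsum_fintype (L := .unconditional V), PMF.tsum_map_mul]
    simp only [tsum_fintype]

/-! ### Product laws -/

lemma productPMF_apply {ι : Type} [Fintype ι] {α : ι → Type} [∀ i, Countable (α i)]
    (p : ∀ i, PMF (α i)) (x : ∀ i, α i) : productPMF p x = ∏ i, p i (x i) := rfl

lemma PMF.map_apply_of_injective {X Y : Type} (p : PMF X) {f : X → Y} (hf : f.Injective) {x : X}
    {y : Y} (hy : f x = y) : p.map f y = p x := by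
  classical
  subst hy
  rw [PMF.map_apply, tsum_eq_single x]
  · simp
  · intro x' hx'
    rw [if_neg]
    exact fun h => hx' (hf h).symm

/-- Sampling one coordinate at a time lets the independent choices keep pace with the gradual
revealing of the matching. -/
lemma productPMF_succ {V : Type} [Countable V] (w : PMF V) (K : ℕ) :
    productPMF (fun _ : Fin (K + 1) => w) =
      w.bind fun v => (productPMF fun _ : Fin K => w).map (Fin.cons v) := by
  ext c
  rw [PMF.bind_apply, tsum_eq_single (c 0)]
  · rw [PMF.map_apply_of_injective _ (Fin.cons_right_injective (α := fun _ => V) (c 0))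
        (Fin.cons_self_tail c), productPMF_apply, productPMF_apply, Fin.prod_univ_succ]
    rfl
  · intro v hv
    rw [mul_eq_zero]
    right
    rw [PMF.apply_eq_zero_iff, PMF.mem_support_map_iff]
    rintro ⟨c', -, rfl⟩
    exact hv rfl

lemma productPMF_reindex {V ι κ : Type} [Countable V] [Fintype ι] [Fintype κ] (w : PMF V)
    (e : ι ≃ κ) :
    (productPMF fun _ : κ => w).map (fun c i => c (e i)) = productPMF fun _ : ι => w := by
  ext c
  have hinj : Function.Injective (fun (c : κ → V) i => c (e i)) := by
    intro c c' h
    funext k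
    simpa using congrFun h (e.symm k)
  have hc : c = (fun (c : κ → V) i => c (e i)) (fun k => c (e.symm k)) := by
    funext i
    simp
  rw [PMF.map_apply_of_injective _ hinj (x := fun k => c (e.symm k)) hc.symm,
    productPMF_apply, productPMF_apply]
  rw [← Equiv.prod_comp e]
  simp

lemma productPMF_curry {V ι : Type} {κ : ι → Type} [Countable V] [Fintype ι] [∀ i, Fintype (κ i)]
    (w : PMF V) :
    (productPMF fun _ : (Σ i, κ i) => w).map (fun c i j => c ⟨i, j⟩) =
      productPMF fun i => productPMF fun _ : κ i => w := by
  ext c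
  have hinj : Function.Injective (fun (c : (Σ i, κ i) → V) i j => c ⟨i, j⟩) := by
    intro c c' h
    funext x
    exact congrFun (congrFun h x.1) x.2
  have hc : c = (fun (c : (Σ i, κ i) → V) i j => c ⟨i, j⟩) (fun x => c x.1 x.2) := rfl
  rw [PMF.map_apply_of_injective _ hinj (x := fun x => c x.1 x.2) hc.symm]
  simp only [productPMF_apply]
  exact Fintype.prod_sigma _

lemma productPMF_toOuterMeasure_eval {ι : Type} [Fintype ι] {α : ι → Type} [∀ i, Countable (α i)]
    (p : ∀ i, PMF (α i)) (i : ι) (S : Set (α i)) :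
    (productPMF p).toOuterMeasure {x | x i ∈ S} = (p i).toOuterMeasure S := by
  classical
  let _ : ∀ i, MeasurableSpace (α i) := fun _ => ⊤
  have : ∀ i, MeasurableSingletonClass (α i) := fun _ => ⟨fun _ => trivial⟩
  have h : (Measure.pi fun i => (p i).toMeasure).toPMF = productPMF p := by
    ext x
    rw [Measure.toPMF_apply, Measure.pi_singleton, productPMF_apply]
    refine Finset.prod_congr rfl fun i _ => ?_
    rw [PMF.toMeasure_apply_singleton _ _ (measurableSet_singleton _)]
  rw [← PMF.toMeasure_apply_eq_toOuterMeasure, ← h, Measure.toPMF_toMeasure,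
    ← PMF.toMeasure_apply_eq_toOuterMeasure]
  have := (measurePreserving_eval (fun i => (p i).toMeasure) i).measure_preimage
    (s := S) (MeasurableSet.nullMeasurableSet trivial)
  exact this

/-! ### Uniformly random bijections with partially prescribed values -/

section Matching

variable {L R V : Type} [Fintype L]

open Classical in
/-- The elements that are not matched with elements of `Q`. -/
def unmatched (Q : Finset R) (σ : L ≃ R) : Finset L := Finset.univ.filter fun l => σ l ∉ Q

lemma unmatched_eq {Q : Finset R} {σ σ₀ : L ≃ R} (h : ∀ r ∈ Q, σ.symm r = σ₀.symm r) :
    unmatched Q σ = unmatched Q σ₀ := by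
  ext l
  simp only [unmatched, Finset.mem_filter, Finset.mem_univ, true_and, not_iff_not]
  constructor
  · intro hl
    have := h _ hl
    rw [Equiv.symm_apply_apply] at this
    rw [this]
    simpa using hl
  · intro hl
    have := h _ hl
    rw [Equiv.symm_apply_apply] at this
    rw [← this]
    simpa using hl

open Classical in
/-- The number of elements with image `v` under `g` that are not matched with elements of `Q`. -/
def freeCount (g : L → V) (Q : Finset R) (σ : L ≃ R) (v : V) : ℕ :=
  ((unmatched Q σ).filter fun l => g l = v).card

lemma freeCount_eq (g : L → V) {Q : Finset R} {σ σ₀ : L ≃ R}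
    (h : ∀ r ∈ Q, σ.symm r = σ₀.symm r) : freeCount g Q σ = freeCount g Q σ₀ := by
  funext v
  rw [freeCount, freeCount, unmatched_eq h]

lemma freeCount_union [DecidableEq R] [DecidableEq V] (g : L → V) {Q X : Finset R}
    (h : Disjoint Q X) (σ : L ≃ R) (v : V) :
    freeCount g Q σ v = freeCount g (Q ∪ X) σ v + (X.filter fun x => g (σ.symm x) = v).card := by
  have h1 : (X.filter fun x => g (σ.symm x) = v).card =
      ((X.filter fun x => g (σ.symm x) = v).map σ.symm.toEmbedding).card := by
    rw [Finset.card_map]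
  rw [freeCount, freeCount, h1]
  classical
  rw [← Finset.card_union_of_disjoint]
  · congr 1
    ext l
    simp only [unmatched, Finset.mem_filter, Finset.mem_univ, true_and, Finset.mem_union,
      Finset.mem_map_equiv, Equiv.symm_symm, Equiv.symm_apply_apply]
    have := fun hl : σ l ∈ X => Finset.disjoint_right.1 h hl
    tauto
  · rw [Finset.disjoint_left]
    intro l
    simp only [unmatched, Finset.mem_filter, Finset.mem_univ, true_and, Finset.mem_union,
      Finset.mem_map_equiv, Equiv.symm_symm, Equiv.symm_apply_apply]
    tauto

/-- Each newly revealed socket lowers a single free count by one, hence changes the distance to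
fixed weights by at most one. -/
lemma sum_natAbs_freeCount_union_le [Fintype V] [DecidableEq R] (g : L → V) (a : V → ℤ)
    {Q X : Finset R}
    (h : Disjoint Q X) (σ : L ≃ R) :
    ∑ v, (a v - freeCount g (Q ∪ X) σ v).natAbs ≤
      ∑ v, (a v - freeCount g Q σ v).natAbs + X.card := by
  classical
  rw [Finset.card_eq_sum_card_fiberwise (f := fun x => g (σ.symm x)) (t := Finset.univ)
    (fun _ _ => Finset.mem_coe.2 (Finset.mem_univ _)), ← Finset.sum_add_distrib]
  refine Finset.sum_le_sum fun v _ => ?_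
  have := freeCount_union g h σ v
  omega

lemma sum_freeCount [Fintype V] (g : L → V) (Q : Finset R) (σ : L ≃ R) :
    ∑ v, freeCount g Q σ v = (unmatched Q σ).card := by
  classical
  rw [Finset.card_eq_sum_card_fiberwise (f := g) (t := Finset.univ)
    (fun _ _ => Finset.mem_coe.2 (Finset.mem_univ _))]
  rfl

variable [Fintype R]

open Classical in
/-- The bijections that have the same preimages as `σ₀` on `Q`. -/
def agreeing (Q : Finset R) (σ₀ : L ≃ R) : Finset (L ≃ R) :=
  Finset.univ.filter fun σ => ∀ r ∈ Q, σ.symm r = σ₀.symm r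

lemma mem_agreeing {Q : Finset R} {σ₀ σ : L ≃ R} :
    σ ∈ agreeing Q σ₀ ↔ ∀ r ∈ Q, σ.symm r = σ₀.symm r := by
  simp [agreeing]

lemma self_mem_agreeing (Q : Finset R) (σ₀ : L ≃ R) : σ₀ ∈ agreeing Q σ₀ :=
  mem_agreeing.2 fun _ _ => rfl

/-- The law of a uniformly random bijection that has the same preimages as `σ₀` on `Q`. -/
def matchingLaw (Q : Finset R) (σ₀ : L ≃ R) : PMF (L ≃ R) :=
  PMF.uniformOfFinset (agreeing Q σ₀)
    (show (agreeing Q σ₀).Nonempty from ⟨σ₀, self_mem_agreeing Q σ₀⟩)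

open Classical in
lemma matchingLaw_apply (Q : Finset R) (σ₀ σ : L ≃ R) :
    matchingLaw Q σ₀ σ = if σ ∈ agreeing Q σ₀ then ((agreeing Q σ₀).card : ℝ≥0∞)⁻¹ else 0 := by
  rw [matchingLaw, PMF.uniformOfFinset_apply]
  congr

lemma mem_support_matchingLaw {Q : Finset R} {σ₀ σ : L ≃ R} :
    σ ∈ (matchingLaw Q σ₀).support ↔ ∀ r ∈ Q, σ.symm r = σ₀.symm r := by
  rw [matchingLaw, PMF.support_uniformOfFinset, Finset.mem_coe, mem_agreeing]

lemma agreeing_eq_of_mem {Q : Finset R} {σ₀ σ : L ≃ R} (h : σ ∈ agreeing Q σ₀) :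
    agreeing Q σ = agreeing Q σ₀ := by
  ext τ
  rw [mem_agreeing] at h ⊢
  rw [mem_agreeing]
  exact forall₂_congr fun r hr => by rw [h r hr]

lemma mem_agreeing_comm {Q : Finset R} {σ τ : L ≃ R} : σ ∈ agreeing Q τ ↔ τ ∈ agreeing Q σ := by
  rw [mem_agreeing, mem_agreeing]
  exact forall₂_congr fun r _ => eq_comm

/-- Tower property: revealing more partners and then resampling the rest does not change the law.
This is what allows the matching to be exposed step by step. -/
lemma matchingLaw_bind {Q Q' : Finset R} (h : Q ⊆ Q') (σ₀ : L ≃ R) :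
    matchingLaw Q σ₀ = (matchingLaw Q σ₀).bind (matchingLaw Q') := by
  classical
  ext σ
  rw [PMF.bind_apply, tsum_fintype]
  by_cases hσ : σ ∈ agreeing Q σ₀
  · have hsub : agreeing Q' σ ⊆ agreeing Q σ₀ := by
      intro τ hτ
      rw [mem_agreeing] at hτ hσ ⊢
      exact fun r hr => (hτ r (h hr)).trans (hσ r hr)
    -- The classes of agreement on `Q'` refine those on `Q`; only the `τ` in the class of `σ`
    -- contribute, all of them equally.
    have hterm : ∀ τ : L ≃ R, matchingLaw Q σ₀ τ * matchingLaw Q' τ σ =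
        if τ ∈ agreeing Q' σ then
          ((agreeing Q σ₀).card : ℝ≥0∞)⁻¹ * ((agreeing Q' σ).card : ℝ≥0∞)⁻¹ else 0 := by
      intro τ
      rw [matchingLaw_apply, matchingLaw_apply]
      by_cases hτ : τ ∈ agreeing Q' σ
      · rw [if_pos hτ, if_pos (hsub hτ), if_pos (mem_agreeing_comm.1 hτ), agreeing_eq_of_mem hτ]
      · rw [if_neg hτ, if_neg (fun h' => hτ (mem_agreeing_comm.1 h')), mul_zero]
    rw [Finset.sum_congr rfl fun τ _ => hterm τ, Finset.sum_ite_mem, Finset.univ_inter,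
      Finset.sum_const, nsmul_eq_mul, matchingLaw_apply, if_pos hσ, mul_left_comm,
      ENNReal.mul_inv_cancel, mul_one]
    · simpa using Finset.ne_empty_of_mem (self_mem_agreeing Q' σ)
    · exact ENNReal.natCast_ne_top _
  · rw [matchingLaw_apply, if_neg hσ, Finset.sum_eq_zero]
    intro τ _
    rw [matchingLaw_apply, matchingLaw_apply]
    by_cases hτ : τ ∈ agreeing Q σ₀
    · rw [if_neg (c := σ ∈ agreeing Q' τ), mul_zero]
      intro h'
      rw [mem_agreeing] at hτ hσ h'
      exact hσ fun r hr => (h' r (h hr)).trans (hτ r hr)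
    · rw [if_neg hτ, zero_mul]

lemma matchingLaw_empty [Nonempty (L ≃ R)] [Fintype (L ≃ R)] (σ₀ : L ≃ R) :
    PMF.uniformOfFintype (L ≃ R) = matchingLaw ∅ σ₀ := by
  classical
  ext σ
  rw [PMF.uniformOfFintype_apply, matchingLaw_apply, if_pos (by simp [mem_agreeing])]
  congr 2
  rw [← Finset.card_univ]
  congr 1
  ext τ
  simp [mem_agreeing]

lemma PMF.eq_uniformOfFinset {X : Type} (p : PMF X) {S : Finset X} (hS : S.Nonempty)
    (h0 : p.support ⊆ S) (h : ∀ x ∈ S, ∀ y ∈ S, p x = p y) : p = PMF.uniformOfFinset S hS := by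
  classical
  have hsum : ∑ x ∈ S, p x = 1 := by
    rw [← p.tsum_coe, tsum_eq_sum]
    intro x hx
    exact (PMF.apply_eq_zero_iff _ _).2 fun h => hx (h0 h)
  ext x
  rw [PMF.uniformOfFinset_apply]
  split_ifs with hx
  · rw [Finset.sum_congr rfl fun y hy => h y hy x hx, Finset.sum_const, nsmul_eq_mul] at hsum
    exact ENNReal.eq_inv_of_mul_eq_one_left (by rw [mul_comm]; exact hsum)
  · exact (PMF.apply_eq_zero_iff _ _).2 fun h => hx (h0 h)

/-- By symmetry: exchanging two unmatched elements preserves the conditional law, so all of them are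
equally likely partners of `r`. -/
lemma matchingLaw_map_symm (Q : Finset R) (σ₀ : L ≃ R) {r : R} (hr : r ∉ Q) :
    ∃ h : (unmatched Q σ₀).Nonempty,
      (matchingLaw Q σ₀).map (fun σ => σ.symm r) = PMF.uniformOfFinset (unmatched Q σ₀) h := by
  classical
  refine ⟨⟨σ₀.symm r, by simp [unmatched, hr]⟩, ?_⟩
  refine PMF.eq_uniformOfFinset _ _ ?_ ?_
  · intro l hl
    rw [PMF.mem_support_map_iff] at hl
    obtain ⟨σ, hσ, rfl⟩ := hl
    rw [mem_support_matchingLaw] at hσ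
    rw [← unmatched_eq hσ]
    simp [unmatched, hr]
  · intro l hl l' hl'
    let T : (L ≃ R) → (L ≃ R) := fun σ => (Equiv.swap l l').trans σ
    have hT : Function.Injective T := by
      intro σ τ h
      ext x
      have := congrArg (fun σ : L ≃ R => σ (Equiv.swap l l' x)) h
      simpa [T] using this
    have hTT : ∀ σ, T (T σ) = σ := by
      intro σ
      ext x
      simp [T]
    have hne : ∀ r' ∈ Q, σ₀.symm r' ≠ l ∧ σ₀.symm r' ≠ l' := by
      intro r' hr'
      simp only [unmatched, Finset.mem_filter, Finset.mem_univ, true_and] at hl hl'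
      exact ⟨fun h => hl (by rw [← h]; simpa using hr'),
        fun h => hl' (by rw [← h]; simpa using hr')⟩
    have hmem : ∀ σ, σ ∈ agreeing Q σ₀ → T σ ∈ agreeing Q σ₀ := by
      intro σ hσ
      rw [mem_agreeing] at hσ ⊢
      intro r' hr'
      change Equiv.swap l l' (σ.symm r') = _
      rw [hσ r' hr', Equiv.swap_apply_of_ne_of_ne (hne r' hr').1 (hne r' hr').2]
    have hlaw : (matchingLaw Q σ₀).map T = matchingLaw Q σ₀ := by
      ext σ
      rw [PMF.map_apply_of_injective _ hT (hTT σ), matchingLaw_apply, matchingLaw_apply]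
      have : T σ ∈ agreeing Q σ₀ ↔ σ ∈ agreeing Q σ₀ :=
        ⟨fun h => by simpa only [hTT] using hmem _ h, hmem σ⟩
      simp only [this]
    have hmap : ((matchingLaw Q σ₀).map fun σ => σ.symm r).map (Equiv.swap l l') =
        (matchingLaw Q σ₀).map fun σ => σ.symm r := by
      nth_rewrite 2 [← hlaw]
      rw [PMF.map_comp, PMF.map_comp]
      rfl
    nth_rewrite 2 [← hmap]
    rw [PMF.map_apply_of_injective _ (Equiv.swap l l').injective (x := l)]
    simp

/-- The total variation distance of two laws given by integer weights. -/
lemma sum_div_tsub_div_le [Fintype V] (f a : V → ℕ) (hf : 0 < ∑ v, f v) (ha : 0 < ∑ v, a v) :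
    ∑ v, ((f v : ℝ≥0∞) / (∑ v, f v : ℕ) - (a v : ℝ≥0∞) / (∑ v, a v : ℕ)) ≤
      ((∑ v, ((a v : ℤ) - f v).natAbs : ℕ) : ℝ≥0∞) / (∑ v, a v : ℕ) := by
  have one : ∀ b : V → ℕ, 0 < ∑ v, b v → ∑ v, (b v : ℝ≥0∞) / (∑ v, b v : ℕ) = 1 := by
    intro b hb
    simp only [div_eq_mul_inv]
    rw [← Finset.sum_mul, ← Nat.cast_sum, ENNReal.mul_inv_cancel]
    · exact_mod_cast hb.ne'
    · exact ENNReal.natCast_ne_top _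
  have key : ∀ (b c : V → ℕ) (A : ℕ) (v : V), (b v : ℝ≥0∞) / (A : ℕ) - (c v : ℝ≥0∞) / (A : ℕ) ≤
        (((b v - c v : ℕ)) : ℝ≥0∞) / (A : ℕ) := by
    intro b c A v
    rw [tsub_le_iff_right, ← ENNReal.add_div]
    gcongr
    exact_mod_cast (by omega : b v ≤ b v - c v + c v)
  push_cast
  simp only [div_eq_mul_inv]
  rw [Finset.sum_mul]
  simp only [← div_eq_mul_inv]
  simp only [← Nat.cast_sum]
  -- The bound must have denominator `∑ a`. If `∑ f` is the larger total, replacing it by `∑ a`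
  -- increases the positive term. Otherwise the symmetry of total variation is used first, so that
  -- the replacement decreases the subtracted term.
  rcases le_total (∑ v, a v) (∑ v, f v) with h | h
  · refine Finset.sum_le_sum fun v _ => ?_
    calc (f v : ℝ≥0∞) / (∑ v, f v : ℕ) - (a v : ℝ≥0∞) / (∑ v, a v : ℕ)
        ≤ (f v : ℝ≥0∞) / (∑ v, a v : ℕ) - (a v : ℝ≥0∞) / (∑ v, a v : ℕ) := by gcongr
      _ ≤ (((f v - a v : ℕ)) : ℝ≥0∞) / (∑ v, a v : ℕ) := key f a _ v
      _ ≤ _ := by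
        gcongr
        omega
  · have hswap : ∑ v, ((f v : ℝ≥0∞) / (∑ v, f v : ℕ) - (a v : ℝ≥0∞) / (∑ v, a v : ℕ)) =
        ∑ v, ((a v : ℝ≥0∞) / (∑ v, a v : ℕ) - (f v : ℝ≥0∞) / (∑ v, f v : ℕ)) := by
      have h1 : ∑ v, ((f v : ℝ≥0∞) / (∑ v, f v : ℕ) +
          ((a v : ℝ≥0∞) / (∑ v, a v : ℕ) - (f v : ℝ≥0∞) / (∑ v, f v : ℕ))) =
          ∑ v, ((a v : ℝ≥0∞) / (∑ v, a v : ℕ) +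
            ((f v : ℝ≥0∞) / (∑ v, f v : ℕ) - (a v : ℝ≥0∞) / (∑ v, a v : ℕ))) := by
        refine Finset.sum_congr rfl fun v _ => ?_
        rw [add_tsub_eq_max, add_tsub_eq_max, max_comm]
      rw [Finset.sum_add_distrib, Finset.sum_add_distrib, one f hf, one a ha] at h1
      exact ((ENNReal.add_right_inj ENNReal.one_ne_top).1 h1).symm
    rw [hswap]
    refine Finset.sum_le_sum fun v _ => ?_
    calc (a v : ℝ≥0∞) / (∑ v, a v : ℕ) - (f v : ℝ≥0∞) / (∑ v, f v : ℕ)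
        ≤ (a v : ℝ≥0∞) / (∑ v, a v : ℕ) - (f v : ℝ≥0∞) / (∑ v, a v : ℕ) := by gcongr
      _ ≤ (((a v - f v : ℕ)) : ℝ≥0∞) / (∑ v, a v : ℕ) := key a f _ v
      _ ≤ _ := by
        gcongr
        omega

lemma matchingLaw_map_node [Fintype V] (g : L → V) (Q : Finset R) (σ₀ : L ≃ R) {r : R}
    (hr : r ∉ Q) :
    0 < ∑ v, freeCount g Q σ₀ v ∧ ∀ v, (matchingLaw Q σ₀).map (fun σ => g (σ.symm r)) v =
      (freeCount g Q σ₀ v : ℝ≥0∞) / (∑ v, freeCount g Q σ₀ v : ℕ) := by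
  classical
  obtain ⟨h, h1⟩ := matchingLaw_map_symm Q σ₀ hr
  rw [sum_freeCount]
  refine ⟨Finset.card_pos.2 h, fun v => ?_⟩
  have h2 : (matchingLaw Q σ₀).map (fun σ => g (σ.symm r)) =
      ((matchingLaw Q σ₀).map fun σ => σ.symm r).map g := by
    rw [PMF.map_comp]
    rfl
  rw [h2, h1, PMF.map_apply, tsum_fintype]
  simp only [PMF.uniformOfFinset_apply]
  rw [← Finset.sum_filter, ← Finset.sum_filter, Finset.filter_filter, Finset.sum_const,
    nsmul_eq_mul, div_eq_mul_inv, freeCount]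
  congr 3
  ext l
  simp [unmatched, and_comm, eq_comm]

/-- Coupling of independent choices of nodes, with law proportional to `a`, with the nodes that
are matched with given elements of `R`: the number of differences has an exponential moment. -/
lemma coupledCost_matchingLaw_productPMF [Fintype V] [DecidableEq V] (g : L → V) (a : V → ℕ)
    (w : PMF V) (ha : 0 < ∑ v, a v) (hw : ∀ v, w v = (a v : ℝ≥0∞) / (∑ v, a v : ℕ)) (q : ℝ≥0∞)
    (K : ℕ) :
    ∀ (Q : Finset R) (σ₀ : L ≃ R) (r : Fin K → R), r.Injective → (∀ j, r j ∉ Q) →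
      (1 ≤ q ∨ ((∑ v, ((a v : ℤ) - freeCount g Q σ₀ v).natAbs + K : ℕ) : ℝ≥0∞) ≤
        q * (∑ v, a v : ℕ)) →
      CoupledCost (matchingLaw Q σ₀) (productPMF fun _ : Fin K => w)
        (fun z => 3 ^ (Finset.univ.filter fun j => g (z.1.symm (r j)) ≠ z.2 j).card)
        ((1 + 2 * q) ^ K) := by
  classical
  induction K with
  | zero =>
    intro Q σ₀ r _ _ _
    exact coupledCost_of_le _ _ fun σ _ c _ => by simp
  | succ K ih =>
    intro Q σ₀ r hr hrQ hq
    obtain ⟨hf, hν⟩ := matchingLaw_map_node g Q σ₀ (hrQ 0)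
    have hsub : Q ⊆ Q ∪ {r 0} := Finset.subset_union_left
    have htv : ∑ v, ((matchingLaw Q σ₀).map (fun σ => g (σ.symm (r 0))) v - w v) ≤ q := by
      rcases hq with hq | hq
      · refine le_trans ?_ hq
        refine (Finset.sum_le_sum fun v _ => tsub_le_self).trans ?_
        rw [← tsum_fintype (L := .unconditional V), PMF.tsum_coe]
      · simp only [hν, hw]
        refine (sum_div_tsub_div_le _ _ hf ha).trans ?_
        refine ENNReal.div_le_of_le_mul (le_trans ?_ hq)
        exact_mod_cast Nat.le_add_right _ _
    -- The affine cost is `(1 + 2q)^K` if the first choices agree and three times that if they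
    -- differ; these are the moments left for the other `K` choices, including the factor `3` of a
    -- first difference.
    have h1 := (coupledCost_ne (matchingLaw Q σ₀) (fun σ => g (σ.symm (r 0))) w).affine
      ((1 + 2 * q) ^ K) (2 * (1 + 2 * q) ^ K)
    rw [matchingLaw_bind hsub σ₀, productPMF_succ]
    refine CoupledCost.mono_right (CoupledCost.bind h1 (ψ := fun z : (L ≃ R) × (Fin (K + 1) → V) =>
      3 ^ (Finset.univ.filter fun j => g (z.1.symm (r j)) ≠ z.2 j).card) ?_) ?_
    · intro σ₁ hσ₁ v _
      rw [mem_support_matchingLaw] at hσ₁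
      have hdisj : Disjoint Q {r 0} := Finset.disjoint_singleton_right.2 (hrQ 0)
      have hih := ih (Q ∪ {r 0}) σ₁ (fun j => r j.succ)
        (hr.comp (Fin.succ_injective K)) (by
          intro j
          simp only [Finset.mem_union, Finset.mem_singleton, not_or]
          exact ⟨hrQ _, fun h => Fin.succ_ne_zero j (hr h)⟩) (by
          -- The distance grows by at most one while the number of remaining choices falls by one,
          -- so their sum stays below `q ∑ a`.
          refine hq.imp_right fun hq => le_trans ?_ hq
          have := sum_natAbs_freeCount_union_le g (fun v => (a v : ℤ)) hdisj σ₁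
          rw [freeCount_eq g hσ₁, Finset.card_singleton] at this
          exact Nat.cast_le.2 (by omega))
      rw [← PMF.map_id (matchingLaw (Q ∪ {r 0}) σ₁)]
      refine CoupledCost.map ?_
      refine CoupledCost.mono
        (hih.affine 0 (if g (σ₁.symm (r 0)) = v then 1 else 3)) ?_ ?_
      · intro σ hσ c _
        rw [mem_support_matchingLaw] at hσ
        have h0 : σ.symm (r 0) = σ₁.symm (r 0) := hσ _ (by simp)
        have hcard : (Finset.univ.filter fun j => g (σ.symm (r j)) ≠
            (Fin.cons v c : Fin (K + 1) → V) j).card =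
            (if g (σ₁.symm (r 0)) = v then 0 else 1) +
            (Finset.univ.filter fun j : Fin K => g (σ.symm (r j.succ)) ≠ c j).card := by
          rw [Finset.card_filter, Fin.sum_univ_succ, Finset.card_filter]
          simp only [Fin.cons_zero, Fin.cons_succ, h0]
          congr 1
          split_ifs <;> simp_all
        simp only [id_eq, zero_add]
        rw [hcard, pow_add]
        split_ifs <;> simp
      · simp only [zero_add]
        split_ifs
        · simp
        · simp only [mul_one]
          refine le_of_eq ?_
          ring_nf
    · calc (1 + 2 * q) ^ K + 2 * (1 + 2 * q) ^ K *
            ∑ v, ((matchingLaw Q σ₀).map (fun σ => g (σ.symm (r 0))) v - w v)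
          ≤ (1 + 2 * q) ^ K + 2 * (1 + 2 * q) ^ K * q := by gcongr
        _ = (1 + 2 * q) ^ (K + 1) := by ring

end Matching

/-! ### Rewirings -/

lemma Rewires.add_multiset {V : Type} {r : ℕ} {S T : Multiset (Multiset V)} (h : Rewires r S T)
    (X : Multiset (Multiset V)) : Rewires (r + X.card) S (X + T) := by
  induction X using Multiset.induction_on with
  | empty => simpa using h
  | cons c X ih =>
    rw [Multiset.card_cons, Multiset.cons_add, ← add_assoc]
    exact ih.add c

lemma Rewires.remove_multiset {V : Type} (X : Multiset (Multiset V)) :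
    ∀ {r : ℕ} {S T : Multiset (Multiset V)}, Rewires r S (X + T) → Rewires (r + X.card) S T := by
  induction X using Multiset.induction_on with
  | empty => intro r S T h; simpa using h
  | cons c X ih =>
    intro r S T h
    rw [Multiset.cons_add] at h
    have := ih h.remove
    rwa [Multiset.card_cons, add_comm X.card 1, ← add_assoc]

/-- `S` and `T` have a common part, of which each of them has at most `w` elements more. -/
def NearBy {X : Type} (w : ℕ) (S T : Multiset X) : Prop :=
  ∃ C A B : Multiset X, S = C + A ∧ T = C + B ∧ A.card ≤ w ∧ B.card ≤ w

lemma NearBy.zero {X : Type} (S : Multiset X) : NearBy 0 S S :=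
  ⟨S, 0, 0, by simp, by simp, by simp, by simp⟩

lemma NearBy.add {X : Type} {w w' : ℕ} {S T S' T' : Multiset X} (h : NearBy w S T)
    (h' : NearBy w' S' T') : NearBy (w + w') (S + S') (T + T') := by
  obtain ⟨C, A, B, rfl, rfl, hA, hB⟩ := h
  obtain ⟨C', A', B', rfl, rfl, hA', hB'⟩ := h'
  refine ⟨C + C', A + A', B + B', by abel, by abel, ?_, ?_⟩ <;> rw [Multiset.card_add] <;> omega

lemma NearBy.mono {X : Type} {w w' : ℕ} {S T : Multiset X} (h : NearBy w S T) (hw : w ≤ w') :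
    NearBy w' S T := by
  obtain ⟨C, A, B, hS, hT, hA, hB⟩ := h
  exact ⟨C, A, B, hS, hT, hA.trans hw, hB.trans hw⟩

lemma NearBy.rewires {V : Type} {w : ℕ} {S T : Multiset (Multiset V)} (h : NearBy w S T)
    (X : Multiset (Multiset V)) : ∃ r ≤ 2 * w + X.card, Rewires r S (T + X) := by
  obtain ⟨C, A, B, rfl, rfl, hA, hB⟩ := h
  have h1 : Rewires (0 + A.card) (C + A) C :=
    Rewires.remove_multiset A (by rw [add_comm A C]; exact Rewires.refl _)
  have h2 := h1.add_multiset (B + X)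
  refine ⟨0 + A.card + (B + X).card, ?_, ?_⟩
  · rw [Multiset.card_add]
    omega
  · rwa [add_comm (B + X), ← add_assoc] at h2

lemma nearBy_map {ι X : Type} [DecidableEq X] (s : Multiset ι) (f g : ι → X) :
    NearBy (s.filter fun i => f i ≠ g i).card (s.map f) (s.map g) := by
  refine ⟨(s.filter fun i => f i = g i).map f, (s.filter fun i => f i ≠ g i).map f,
    (s.filter fun i => f i ≠ g i).map g, ?_, ?_, by simp, by simp⟩
  · rw [← Multiset.map_add, Multiset.filter_add_not]
  · have h : (s.filter fun i => f i = g i).map f = (s.filter fun i => f i = g i).map g :=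
      Multiset.map_congr rfl fun i hi => (Multiset.mem_filter.1 hi).2
    rw [h, ← Multiset.map_add, Multiset.filter_add_not]

/-! ### Function nodes -/

lemma filter_fst_sigma_val {ι : Type} {κ : ι → Type} [Fintype ι] [∀ i, Fintype (κ i)]
    [DecidableEq ι] (a : ι) :
    (Finset.univ : Finset (Σ i, κ i)).val.filter (fun x => x.1 = a) =
      (Finset.univ : Finset (κ a)).val.map (Sigma.mk a) := by
  classical
  have h : (Finset.univ : Finset (Σ i, κ i)).filter (fun x => x.1 = a) =
      (Finset.univ : Finset (κ a)).map ⟨Sigma.mk a, sigma_mk_injective⟩ := by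
    ext ⟨i, j⟩
    simp only [Finset.mem_filter, Finset.mem_univ, true_and, Finset.mem_map,
      Function.Embedding.coeFn_mk]
    constructor
    · rintro rfl
      exact ⟨j, rfl⟩
    · rintro ⟨j', h⟩
      exact (congrArg Sigma.fst h).symm
  exact congrArg Finset.val h

/-- The variable nodes that the check node `a` is connected to in the standard ensemble. -/
def socketNbhd {n m : ℕ} {Λ P : ℝ[X]} {d : NodePartition n Λ} {e : NodePartition m P}
    (σ : d.Socket ≃ e.Socket) (a : Fin m) : Multiset (Fin n) :=
  (Finset.univ : Finset (Fin (e.deg a))).val.map fun j => (σ.symm ⟨a, j⟩).1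

/-- Listing the edges by their right sockets turns each neighborhood into a fibre of the sigma type.
-/
lemma functionNodes_socketGraph {n m : ℕ} {Λ P : ℝ[X]} {d : NodePartition n Λ}
    {e : NodePartition m P} (σ : d.Socket ≃ e.Socket) :
    (socketGraph d e σ).functionNodes = (Finset.univ : Finset (Fin m)).val.map (socketNbhd σ) := by
  unfold TannerGraph.functionNodes
  refine Multiset.map_congr rfl fun a _ => ?_
  have hσ : (Finset.univ : Finset d.Socket).val =
      (Finset.univ : Finset e.Socket).val.map σ.symm :=
    (congrArg Finset.val (Finset.map_univ_equiv σ.symm)).symm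
  simp only [TannerGraph.nbhd, socketGraph]
  rw [hσ, Multiset.map_map, Multiset.filter_map, Multiset.map_map]
  simp only [Function.comp_def, Equiv.apply_symm_apply]
  rw [filter_fst_sigma_val, Multiset.map_map]
  rfl

/-- The round number in the names makes the new names fresh, so old neighborhoods are untouched and
no two check nodes merge. -/
lemma functionNodes_update {n : ℕ} {P : ℝ[X]} (s : State n) (t : ℕ)
    (hs : ∀ a ∈ s.graph.checks, a.2.2 < t) (m : ↥(Finset.Icc 2 P.natDegree) → ℕ)
    (c : RoundChoice n P m) :
    (s.update t m c).graph.functionNodes = s.graph.functionNodes +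
      (Finset.univ : Finset (RoundCheck P m)).val.map
        fun a => (Finset.univ : Finset (Fin a.1)).val.map (c a) := by
  classical
  let name : RoundCheck P m → ℕ × ℕ × ℕ := fun a => ((a.2 : ℕ), (a.1 : ℕ), t)
  have hname : Function.Injective name := by
    rintro ⟨k, a⟩ ⟨k', a'⟩ h
    simp only [name, Prod.mk.injEq, and_true] at h
    obtain rfl : k = k' := Subtype.ext h.2
    obtain rfl : a = a' := Fin.ext h.1
    rfl
  have hdisj : Disjoint s.graph.checks ((Finset.univ : Finset (RoundCheck P m)).image name) := by
    rw [Finset.disjoint_left]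
    intro a ha ha'
    obtain ⟨x, -, rfl⟩ := Finset.mem_image.1 ha'
    exact lt_irrefl _ (hs _ ha)
  have hchecks : (s.update t m c).graph.checks.val =
      s.graph.checks.val + (Finset.univ : Finset (RoundCheck P m)).val.map name := by
    have h1 : (s.update t m c).graph.checks =
        s.graph.checks.disjUnion ((Finset.univ : Finset (RoundCheck P m)).image name) hdisj := by
      rw [Finset.disjUnion_eq_union]
      change s.graph.checks ∪ _ = _
      congr 1
    rw [h1]
    change _ + _ = _
    rw [Finset.image_val_of_injOn hname.injOn]
  rw [TannerGraph.functionNodes, hchecks, Multiset.map_add, TannerGraph.functionNodes,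
    Multiset.map_map]
  have hedges : (s.update t m c).graph.edges = s.graph.edges +
        (Finset.univ : Finset (Σ a : RoundCheck P m, Fin a.1)).val.map
          fun x => (c x.1 x.2, name x.1) := rfl
  congr 1
  · refine Multiset.map_congr rfl fun a ha => ?_
    rw [TannerGraph.nbhd, TannerGraph.nbhd, hedges, Multiset.filter_add, Multiset.map_add]
    rw [(Multiset.filter_eq_nil (s := Multiset.map _ _)).2, Multiset.map_zero, add_zero]
    intro e he
    obtain ⟨x, -, rfl⟩ := Multiset.mem_map.1 he
    rintro rfl
    exact lt_irrefl _ (hs _ ha)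
  · refine Multiset.map_congr rfl fun a _ => ?_
    rw [Function.comp_apply, TannerGraph.nbhd, hedges, Multiset.filter_add, Multiset.map_add]
    rw [(Multiset.filter_eq_nil (s := s.graph.edges)).2, Multiset.map_zero, zero_add,
      Multiset.filter_map, Multiset.map_map]
    · simp only [Function.comp_def, hname.eq_iff]
      rw [filter_fst_sigma_val, Multiset.map_map]
      rfl
    · intro e he h
      have := hs _ (s.graph.snd_mem e he)
      rw [h] at this
      exact lt_irrefl _ this

lemma checks_update_lt {n : ℕ} {P : ℝ[X]} (s : State n) (t : ℕ)
    (hs : ∀ a ∈ s.graph.checks, a.2.2 < t) (m : ↥(Finset.Icc 2 P.natDegree) → ℕ)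
    (c : RoundChoice n P m) : ∀ a ∈ (s.update t m c).graph.checks, a.2.2 < t + 1 := by
  intro a ha
  rcases Finset.mem_union.1 ha with h | h
  · exact (hs a h).trans (Nat.lt_succ_self t)
  · obtain ⟨x, -, rfl⟩ := Finset.mem_image.1 h
    exact Nat.lt_succ_self t

/-- The function nodes added in one round, compared with the function nodes of the standard
ensemble to whose sockets the choices are coupled. -/
lemma nearBy_round {n M : ℕ} {Λ P : ℝ[X]} {d : NodePartition n Λ} {e : NodePartition M P}
    (σ : d.Socket ≃ e.Socket) (m : ↥(Finset.Icc 2 P.natDegree) → ℕ) (c : RoundChoice n P m)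
    (f : RoundCheck P m ↪ Fin M) (hf : ∀ a, e.deg (f a) = a.1) :
    NearBy ((Finset.univ : Finset (Σ a : RoundCheck P m, Fin a.1)).filter
        fun x => (σ.symm ⟨f x.1, Fin.cast (hf x.1).symm x.2⟩).1 ≠ c x.1 x.2).card
      ((Finset.univ : Finset (RoundCheck P m)).val.map
        fun a => (Finset.univ : Finset (Fin a.1)).val.map (c a))
      ((Finset.univ.map f).val.map (socketNbhd σ)) := by
  classical
  have h1 : ∀ a : RoundCheck P m, socketNbhd σ (f a) =
      (Finset.univ : Finset (Fin a.1)).val.map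
        fun j => (σ.symm ⟨f a, Fin.cast (hf a).symm j⟩).1 := by
    intro a
    have h2 : (Finset.univ : Finset (Fin (e.deg (f a)))).val =
        (Finset.univ : Finset (Fin a.1)).val.map (finCongr (hf a).symm) :=
      (congrArg Finset.val (Finset.map_univ_equiv (finCongr (hf a).symm))).symm
    rw [socketNbhd, h2, Multiset.map_map]
    rfl
  rw [Finset.map_val, Multiset.map_map]
  refine (nearBy_map _ _ _).mono ?_
  change (Finset.univ.filter fun a : RoundCheck P m =>
    (Finset.univ : Finset (Fin a.1)).val.map (c a) ≠ (socketNbhd σ ∘ f) a).card ≤ _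
  -- A check node can differ only if one of its sockets does, so differing nodes are counted by the
  -- image of the differing sockets.
  refine le_trans (Finset.card_le_card (t := Finset.image Sigma.fst
    ((Finset.univ : Finset (Σ a : RoundCheck P m, Fin a.1)).filter
      fun x => (σ.symm ⟨f x.1, Fin.cast (hf x.1).symm x.2⟩).1 ≠ c x.1 x.2)) ?_)
    Finset.card_image_le
  intro a ha
  rw [Finset.mem_filter] at ha
  by_contra hcon
  refine ha.2 ?_
  rw [Function.comp_apply, h1]
  refine Multiset.map_congr rfl fun j _ => ?_
  by_contra hj
  exact hcon (Finset.mem_image.2 ⟨⟨a, j⟩, Finset.mem_filter.2 ⟨Finset.mem_univ _, Ne.symm hj⟩, rfl⟩)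

/-! ### Numbers of free sockets -/

/-- Agreeing indices cancel; a disagreeing index contributes at most one at `u x` and one at `c x`,
hence the factor two. -/
lemma sum_natAbs_card_sub_le {ι V : Type} [Fintype ι] [Fintype V] [DecidableEq V] (u c : ι → V) :
    ∑ v, (((Finset.univ.filter fun x => u x = v).card : ℤ) -
      (Finset.univ.filter fun x => c x = v).card).natAbs ≤
      2 * (Finset.univ.filter fun x => u x ≠ c x).card := by
  have hsplit : ∀ f : ι → V, ∀ v, (Finset.univ.filter fun x => f x = v).card =
      (Finset.univ.filter fun x => f x = v ∧ u x = c x).card +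
      ((Finset.univ.filter fun x => u x ≠ c x).filter fun x => f x = v).card := by
    intro f v
    rw [← Finset.card_filter_add_card_filter_not (s := Finset.univ.filter fun x => f x = v)
      (fun x => u x = c x), Finset.filter_filter, Finset.filter_filter, Finset.filter_filter]
    congr 2
    ext x
    simp [and_comm]
  have hsum : ∀ f : ι → V, ∑ v, ((Finset.univ.filter fun x => u x ≠ c x).filter
      fun x => f x = v).card = (Finset.univ.filter fun x => u x ≠ c x).card :=
    fun f => (Finset.card_eq_sum_card_fiberwise
      (fun _ _ => Finset.mem_coe.2 (Finset.mem_univ _))).symm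
  rw [two_mul]
  nth_rewrite 1 [← hsum u]
  rw [← hsum c, ← Finset.sum_add_distrib]
  refine Finset.sum_le_sum fun v _ => ?_
  have h1 := hsplit u v
  have h2 := hsplit c v
  have h3 : (Finset.univ.filter fun x => u x = v ∧ u x = c x).card =
      (Finset.univ.filter fun x => c x = v ∧ u x = c x).card := by
    congr 1
    ext x
    simp only [Finset.mem_filter, Finset.mem_univ, true_and]
    constructor
    · rintro ⟨rfl, h⟩
      exact ⟨h.symm, h⟩
    · rintro ⟨rfl, h⟩
      exact ⟨h, h⟩
  omega

lemma sum_natAbs_free_update_le {L R ι V : Type} [Fintype L] [DecidableEq R] [Fintype ι] [Fintype V]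
    [DecidableEq V] (g : L → V) (Q : Finset R) (σ : L ≃ R) (r : ι ↪ R) (hr : ∀ x, r x ∉ Q)
    (free : V → ℤ) (c : ι → V) :
    ∑ v, (free v - (Finset.univ.filter fun x => c x = v).card -
        freeCount g (Q ∪ Finset.univ.map r) σ v).natAbs ≤
      ∑ v, (free v - freeCount g Q σ v).natAbs +
        2 * (Finset.univ.filter fun x => g (σ.symm (r x)) ≠ c x).card := by
  classical
  have hdisj : Disjoint Q (Finset.univ.map r) := by
    rw [Finset.disjoint_right]
    intro x hx
    obtain ⟨y, -, rfl⟩ := Finset.mem_map.1 hx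
    exact hr y
  refine le_trans ?_ (Nat.add_le_add_left
    (sum_natAbs_card_sub_le (fun x => g (σ.symm (r x))) c) _)
  rw [← Finset.sum_add_distrib]
  refine Finset.sum_le_sum fun v _ => ?_
  have h1 := freeCount_union g hdisj σ v
  have h2 : ((Finset.univ.map r).filter fun x => g (σ.symm x) = v).card =
      (Finset.univ.filter fun x => g (σ.symm (r x)) = v).card := by
    rw [Finset.filter_map, Finset.card_map]
    rfl
  rw [h2] at h1
  omega

/-! ### Deviations of Poisson variables -/

/-- The variance comes from the first two factorial moments, each obtained from the previous one by
an index shift. -/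
lemma hasSum_poisson_sq (r : ℝ≥0) :
    HasSum (fun k : ℕ => Real.exp (-r) * (r : ℝ) ^ k / k.factorial * ((k : ℝ) - r) ^ 2) r := by
  have h0 := hasSum_one_poissonMeasure r
  have h1 : HasSum (fun k : ℕ => Real.exp (-r) * (r : ℝ) ^ k / k.factorial * k) r := by
    rw [← hasSum_nat_add_iff' 1]
    have := h0.mul_left (r : ℝ)
    simp only [Finset.sum_range_one, Nat.cast_zero, mul_zero, sub_zero]
    rw [mul_one] at this
    refine this.congr_fun fun k => ?_
    rw [Nat.factorial_succ]
    push_cast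
    have : ((k : ℝ) + 1) ≠ 0 := by positivity
    field_simp
    ring
  have h2 : HasSum (fun k : ℕ => Real.exp (-r) * (r : ℝ) ^ k / k.factorial * (k * (k - 1)))
      ((r : ℝ) * r) := by
    rw [← hasSum_nat_add_iff' 1]
    have := h1.mul_left (r : ℝ)
    simp only [Finset.sum_range_one, Nat.cast_zero, mul_zero, zero_mul, sub_zero]
    refine this.congr_fun fun k => ?_
    rw [Nat.factorial_succ]
    push_cast
    have : ((k : ℝ) + 1) ≠ 0 := by positivity
    field_simp
    ring
  have h3 := (h2.add (h1.mul_left (1 - 2 * (r : ℝ)))).add (h0.mul_left ((r : ℝ) ^ 2))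
  convert h3 using 1
  · funext k
    ring
  · ring

/-- Chebyshev's inequality. -/
lemma poisson_toOuterMeasure_le (r : ℝ≥0) {η : ℝ} (hη : 0 < η) :
    (poissonMeasure r).toPMF.toOuterMeasure {k : ℕ | ¬ |(k : ℝ) - r| ≤ η * r} ≤
      ENNReal.ofReal (1 / (η ^ 2 * r)) := by
  rw [PMF.toOuterMeasure_apply]
  -- Degrees with `P_k = 0` have mean zero: the right side is then `1 / 0 = 0`, and the variable
  -- does vanish almost surely.
  rcases eq_or_lt_of_le r.2 with hr | hr
  · obtain rfl : r = 0 := NNReal.coe_injective hr.symm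
    refine le_trans (le_of_eq ?_) zero_le
    rw [ENNReal.tsum_eq_zero]
    intro k
    rw [Set.indicator_apply_eq_zero]
    intro hk
    rw [Measure.toPMF_apply, poissonMeasure_singleton]
    have : k ≠ 0 := by
      rintro rfl
      simp at hk
    simp [this]
  have hsq := hasSum_poisson_sq r
  have hr' : (0 : ℝ) < r := hr
  have hnn : ∀ k : ℕ, 0 ≤ Real.exp (-r) * (r : ℝ) ^ k / k.factorial * ((k : ℝ) - r) ^ 2 /
      (η * r) ^ 2 := fun k => by positivity
  have hs : HasSum (fun k : ℕ => Real.exp (-r) * (r : ℝ) ^ k / k.factorial * ((k : ℝ) - r) ^ 2 /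
      (η * r) ^ 2) (1 / (η ^ 2 * r)) := by
    have h : 1 / (η ^ 2 * (r : ℝ)) = (r : ℝ) / (η * r) ^ 2 := by
      rw [div_eq_div_iff (by positivity) (by positivity)]
      ring
    rw [h]
    exact hsq.div_const _
  rw [← hs.tsum_eq, ENNReal.ofReal_tsum_of_nonneg hnn hs.summable]
  refine ENNReal.tsum_le_tsum fun k => Set.indicator_apply_le' (fun hk => ?_) fun _ => zero_le
  rw [Measure.toPMF_apply, poissonMeasure_singleton]
  refine ENNReal.ofReal_le_ofReal ?_
  rw [mul_div_assoc (Real.exp (-r) * (r : ℝ) ^ k / k.factorial)]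
  refine le_mul_of_one_le_right (by positivity) ?_
  rw [one_le_div (by positivity), ← sq_abs ((k : ℝ) - r)]
  simp only [Set.mem_ofPred_eq, not_le] at hk
  gcongr

/-- With high probability all the numbers of check nodes added in one round are close to their
means. -/
lemma productPMF_poisson_le {ι : Type} [Fintype ι] (r : ι → ℝ) (hr : ∀ i, 0 ≤ r i) {η : ℝ}
    (hη : 0 < η) :
    (productPMF fun i => (poissonMeasure (r i).toNNReal).toPMF).toOuterMeasure
        {m | ¬ ∀ i, |(m i : ℝ) - r i| ≤ η * r i} ≤
      ENNReal.ofReal (∑ i, 1 / (η ^ 2 * r i)) := by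
  have hset : {m : ι → ℕ | ¬ ∀ i, |(m i : ℝ) - r i| ≤ η * r i} =
      ⋃ i ∈ (Finset.univ : Finset ι), {m | m i ∈ {k : ℕ | ¬ |(k : ℝ) - r i| ≤ η * r i}} := by
    ext m
    simp
  rw [hset, ENNReal.ofReal_sum_of_nonneg fun i _ =>
    one_div_nonneg.2 (mul_nonneg (sq_nonneg _) (hr i))]
  refine (measure_biUnion_finset_le _ _).trans (Finset.sum_le_sum fun i _ => ?_)
  rw [productPMF_toOuterMeasure_eval]
  have := poisson_toOuterMeasure_le (r i).toNNReal hη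
  rwa [Real.coe_toNNReal _ (hr i)] at this

/-! ### The growth of the number of differences -/

/-- A bound for the number of differences per variable node, when `g` is a bound for the number of
sockets per variable node that are used in one round, and `D` is the average degree. -/
def diffBound (D g : ℝ) : ℕ → ℝ
  | 0 => 0
  | t + 1 => diffBound D g t + 3 * g * min 1 ((2 * diffBound D g t + g) / (D - g * t))

/-- With `r = D - gt` and `y = 2x + g`, where `x` is the current value of `diffBound`, the product
`y r^6` does not increase, so `y ≤ g D^6 / ρ^6 = ρ D^6` as long as `r ≥ ρ = g^{1/7}`. Below `ρ` each
step adds at most `6g` to `y` and takes `g` from `r`, so `y + 6r` does not increase. -/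
lemma diffBound_le {D g : ℝ} (hg : 0 < g) (hg2 : g ≤ 2) {T : ℕ} (hT : g * T ≤ D) :
    diffBound D g T ≤ (D ^ 6 + 390) * g ^ (1 / 7 : ℝ) := by
  obtain ⟨ρ, hρ⟩ : ∃ ρ, ρ = g ^ (1 / 7 : ℝ) := ⟨_, rfl⟩
  rw [← hρ]
  have hρ0 : 0 < ρ := by rw [hρ]; positivity
  have hρ7 : ρ ^ 7 = g := by
    rw [hρ, ← Real.rpow_natCast, ← Real.rpow_mul hg.le]
    norm_num
  have hρ2 : ρ ≤ 2 := by
    by_contra! h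
    have : (2 : ℝ) ^ 7 < ρ ^ 7 := by gcongr
    rw [hρ7] at this
    norm_num at this
    linarith
  -- This is the origin of `390 = 6 * 64 + 6`, from the error `6g + 6ρ` of the final phase.
  have hgρ : g ≤ 64 * ρ := by
    rw [← hρ7]
    have : ρ ^ 6 ≤ 2 ^ 6 := by gcongr
    nlinarith
  have hmono : ∀ {t : ℕ}, t ≤ T → g * t ≤ D := fun {t} ht =>
    le_trans (mul_le_mul_of_nonneg_left (by exact_mod_cast ht) hg.le) hT
  have inv : ∀ t : ℕ, t ≤ T → 0 ≤ diffBound D g t ∧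
      (2 * diffBound D g t + g) * (D - g * t) ^ 6 ≤ g * D ^ 6 ∧
      (ρ ≤ D - g * t ∨ (2 * diffBound D g t + g) + 6 * (D - g * t) ≤
        ρ * D ^ 6 + 6 * g + 6 * ρ) := by
    intro t
    induction t with
    | zero =>
      intro _
      refine ⟨le_rfl, by simp [diffBound], ?_⟩
      by_cases h : ρ ≤ D
      · left
        simpa using h
      · right
        have hD : 0 ≤ D := by simpa using hmono (Nat.zero_le T)
        simp only [diffBound, Nat.cast_zero, mul_zero, sub_zero]
        have : 0 ≤ ρ * D ^ 6 := by positivity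
        linarith
    | succ t ih =>
      intro ht
      obtain ⟨h0, h1, h2⟩ := ih (by omega)
      have hr := hmono ht
      push_cast at hr ⊢
      set x := diffBound D g t with hx
      have hx' : diffBound D g (t + 1) = x + 3 * g * min 1 ((2 * x + g) / (D - g * t)) := rfl
      obtain ⟨r, hr_def⟩ : ∃ r, r = D - g * t := ⟨_, rfl⟩
      rw [← hr_def] at h1 h2 hx'
      have hrg : g ≤ r := by rw [hr_def]; linarith
      have hr' : D - g * (t + 1) = r - g := by rw [hr_def]; ring
      rw [hr', hx']
      have hr0 : 0 < r := hg.trans_le hrg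
      have hq0 : 0 ≤ min 1 ((2 * x + g) / r) := le_min zero_le_one (by positivity)
      refine ⟨by positivity, ?_, ?_⟩
      · refine le_trans ?_ h1
        have hle : 2 * (x + 3 * g * min 1 ((2 * x + g) / r)) + g ≤
            (2 * x + g) * (r + 6 * g) / r := by
          have : min 1 ((2 * x + g) / r) ≤ (2 * x + g) / r := min_le_right _ _
          calc 2 * (x + 3 * g * min 1 ((2 * x + g) / r)) + g
              ≤ 2 * (x + 3 * g * ((2 * x + g) / r)) + g := by gcongr
            _ = _ := by field_simp; ring
        -- An instance of the inequality of arithmetic and geometric means: the seven factors on the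
        -- left have mean `r`. It explains the exponent `6`.
        have hpow : (r + 6 * g) * (r - g) ^ 6 ≤ r ^ 7 := by
          obtain ⟨s, hs⟩ : ∃ s, s = r - g := ⟨_, rfl⟩
          have hs0 : 0 ≤ s := by rw [hs]; linarith
          have hrs : r = s + g := by rw [hs]; ring
          rw [hrs]
          have : 0 ≤ 21 * s ^ 5 * g ^ 2 + 35 * s ^ 4 * g ^ 3 + 35 * s ^ 3 * g ^ 4 +
            21 * s ^ 2 * g ^ 5 + 7 * s * g ^ 6 + g ^ 7 := by positivity
          linarith [show (s + g) ^ 7 - (s + g + 6 * g) * (s + g - g) ^ 6 =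
            21 * s ^ 5 * g ^ 2 + 35 * s ^ 4 * g ^ 3 + 35 * s ^ 3 * g ^ 4 +
            21 * s ^ 2 * g ^ 5 + 7 * s * g ^ 6 + g ^ 7 by ring]
        have h6 : 0 ≤ (r - g) ^ 6 := pow_nonneg (by linarith) 6
        calc (2 * (x + 3 * g * min 1 ((2 * x + g) / r)) + g) * (r - g) ^ 6
            ≤ (2 * x + g) * (r + 6 * g) / r * (r - g) ^ 6 := by gcongr
          _ = (2 * x + g) * ((r + 6 * g) * (r - g) ^ 6) / r := by ring
          _ ≤ (2 * x + g) * r ^ 7 / r := by gcongr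
          _ = (2 * x + g) * r ^ 6 := by field_simp
      · have hq1 : min 1 ((2 * x + g) / r) ≤ 1 := min_le_left _ _
        have hstep : 3 * g * min 1 ((2 * x + g) / r) ≤ 3 * g :=
          mul_le_of_le_one_right (by positivity) hq1
        by_cases hcase : ρ ≤ r - g
        · exact Or.inl hcase
        right
        push Not at hcase
        rcases h2 with h2 | h2
        · have h3 : (2 * x + g) * ρ ^ 6 ≤ ρ * D ^ 6 * ρ ^ 6 := by
            calc (2 * x + g) * ρ ^ 6 ≤ (2 * x + g) * r ^ 6 := by gcongr
              _ ≤ g * D ^ 6 := h1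
              _ = ρ * D ^ 6 * ρ ^ 6 := by rw [← hρ7]; ring
          have h4 : 2 * x + g ≤ ρ * D ^ 6 := le_of_mul_le_mul_right h3 (by positivity)
          linarith
        · linarith
  obtain ⟨h0, h1, h2⟩ := inv T le_rfl
  have hD6 : 0 ≤ ρ * D ^ 6 := by positivity
  rcases h2 with h2 | h2
  · have h3 : (2 * diffBound D g T + g) * ρ ^ 6 ≤ ρ * D ^ 6 * ρ ^ 6 := by
      calc (2 * diffBound D g T + g) * ρ ^ 6
          ≤ (2 * diffBound D g T + g) * (D - g * T) ^ 6 := by gcongr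
        _ ≤ g * D ^ 6 := h1
        _ = ρ * D ^ 6 * ρ ^ 6 := by rw [← hρ7]; ring
    have h4 : 2 * diffBound D g T + g ≤ ρ * D ^ 6 := le_of_mul_le_mul_right h3 (by positivity)
    nlinarith
  · nlinarith

lemma diffBound_nonneg {D g : ℝ} (hg : 0 < g) {t : ℕ} (ht : g * t ≤ D) :
    0 ≤ diffBound D g t := by
  induction t with
  | zero => exact le_rfl
  | succ t ih =>
    push_cast at ht
    have h0 := ih (by linarith)
    have h1 : 0 < D - g * t := by linarith
    have h2 : 0 ≤ min 1 ((2 * diffBound D g t + g) / (D - g * t)) :=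
      le_min zero_le_one (by positivity)
    rw [diffBound]
    positivity

/-! ### One round of the multi-Poisson ensemble -/

lemma coupledCost_matchingLaw_productPMF_fintype {L R V ι : Type} [Fintype L] [Fintype R]
    [Fintype V] [Fintype ι] [DecidableEq V] (g : L → V) (a : V → ℕ) (w : PMF V)
    (ha : 0 < ∑ v, a v) (hw : ∀ v, w v = (a v : ℝ≥0∞) / (∑ v, a v : ℕ)) (q : ℝ≥0∞)
    (Q : Finset R) (σ₀ : L ≃ R) (r : ι ↪ R) (hrQ : ∀ j, r j ∉ Q)
    (hq : 1 ≤ q ∨ ((∑ v, ((a v : ℤ) - freeCount g Q σ₀ v).natAbs + Fintype.card ι : ℕ) : ℝ≥0∞) ≤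
      q * (∑ v, a v : ℕ)) :
    CoupledCost (matchingLaw Q σ₀) (productPMF fun _ : ι => w)
      (fun z => 3 ^ (Finset.univ.filter fun j => g (z.1.symm (r j)) ≠ z.2 j).card)
      ((1 + 2 * q) ^ Fintype.card ι) := by
  classical
  let e := Fintype.equivFin ι
  have h := coupledCost_matchingLaw_productPMF g a w ha hw q (Fintype.card ι) Q σ₀
    (fun j => r (e.symm j)) (r.injective.comp e.symm.injective) (fun j => hrQ _) hq
  rw [← productPMF_reindex w e, ← PMF.map_id (matchingLaw Q σ₀)]
  refine CoupledCost.map (h.mono (fun σ _ c _ => le_of_eq ?_) le_rfl)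
  congr 1
  refine Finset.card_equiv e fun i => ?_
  simp

/-- The sockets of a set of nodes. -/
def socketsOf {N : ℕ} {Q : ℝ[X]} (e : NodePartition N Q) (B : Finset (Fin N)) : Finset e.Socket :=
  B.sigma fun _ => Finset.univ

lemma mem_socketsOf {N : ℕ} {Q : ℝ[X]} {e : NodePartition N Q} {B : Finset (Fin N)}
    {x : e.Socket} : x ∈ socketsOf e B ↔ x.1 ∈ B := by
  simp [socketsOf]

/-- The average number of check nodes of degree `k`, per variable node, added in one round. -/
def roundMean (P : ℝ[X]) (γ : ℝ) (k : ℕ) : ℝ := γ * P.coeff k / meanDegree P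

lemma roundMean_nonneg {P : ℝ[X]} (hP : IsDegreeSequence P) {γ : ℝ} (hγ : 0 < γ) (k : ℕ) :
    0 ≤ roundMean P γ k :=
  div_nonneg (mul_nonneg hγ.le (hP.nonneg k)) hP.meanDegree_pos.le

lemma sum_roundMean_mul {P : ℝ[X]} (hP : IsDegreeSequence P) (γ : ℝ) :
    ∑ k : ↥(Finset.Icc 2 P.natDegree), roundMean P γ k * (k : ℕ) = γ := by
  have h : ∀ k : ↥(Finset.Icc 2 P.natDegree), roundMean P γ k * (k : ℕ) =
      γ / meanDegree P * (P.coeff k * (k : ℕ)) := fun k => by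
    rw [roundMean]
    ring
  simp only [h]
  rw [← Finset.mul_sum, hP.sum_coeff_mul, div_mul_cancel₀ _ hP.meanDegree_pos.ne']

lemma sum_roundMean {P : ℝ[X]} (hP : IsDegreeSequence P) (γ : ℝ) :
    ∑ k : ↥(Finset.Icc 2 P.natDegree), roundMean P γ k = γ / meanDegree P := by
  have h : ∀ k : ↥(Finset.Icc 2 P.natDegree), roundMean P γ k =
      γ / meanDegree P * P.coeff k := fun k => by
    rw [roundMean]
    ring
  simp only [h]
  rw [← Finset.mul_sum, hP.sum_coeff, mul_one]

/-! ### The relation between the two constructions and its preservation -/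

section Round

variable {n M : ℕ} {Λ P : ℝ[X]} {d : NodePartition n Λ} {e : NodePartition M P}

/-- The relation that is kept, with high probability, between the state `s` of the multi-Poisson
construction after `t` rounds and the restriction of the matching `σ` of the standard ensemble to
the sockets of a set `B` of check nodes. -/
structure RoundInv (γ η : ℝ) (t : ℕ) (s : State n) (B : Finset (Fin M))
    (σ : d.Socket ≃ e.Socket) : Prop where
  names : ∀ a ∈ s.graph.checks, a.2.2 < t
  total : n * (meanDegree Λ - γ * (1 + η) * t) ≤ ∑ i, (s.free i : ℝ)
  card_class : ∀ k, |((B.filter fun a => e.1 a = k).card : ℝ) - t * (n * roundMean P γ k)| ≤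
    t * (η * (n * roundMean P γ k))
  near : ∃ W : ℕ, (W : ℝ) ≤ n * diffBound (meanDegree Λ) (γ * (1 + η)) t ∧
    NearBy W s.graph.functionNodes (B.val.map (socketNbhd σ)) ∧
    ∑ i, (s.free i - freeCount Sigma.fst (socketsOf e B) σ i).natAbs ≤ 2 * W

/-- The class of degree `k` has `M P_k` nodes, so `hm` leaves enough of them outside `B`, separately
for each degree. -/
lemma exists_new_checks (B : Finset (Fin M)) (m : ↥(Finset.Icc 2 P.natDegree) → ℕ)
    (hm : ∀ k, ((B.filter fun a => e.1 a = k).card : ℝ) + m k ≤ M * P.coeff k) :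
    ∃ f : RoundCheck P m ↪ Fin M, (∀ a, f a ∉ B) ∧ ∀ a, e.1 (f a) = a.1 := by
  classical
  have h : ∀ k, Nonempty (Fin (m k) ↪ {a : Fin M // a ∉ B ∧ e.1 a = k}) := by
    intro k
    refine Function.Embedding.nonempty_of_card_le ?_
    rw [Fintype.card_fin, Fintype.card_subtype]
    have h1 : (Finset.univ.filter fun a => e.1 a = k).card =
        (B.filter fun a => e.1 a = k).card +
          (Finset.univ.filter fun a => a ∉ B ∧ e.1 a = k).card := by
      rw [← Finset.card_filter_add_card_filter_not (s := Finset.univ.filter fun a => e.1 a = k)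
        (fun a => a ∈ B), Finset.filter_filter, Finset.filter_filter]
      congr 2
      · ext a
        simp [and_comm]
      · ext a
        simp [and_comm]
    have h2 := hm k
    rw [← e.2 k, h1] at h2
    push_cast at h2
    exact_mod_cast (add_le_add_iff_left _).1 h2
  refine ⟨⟨fun a => ((h a.1).some a.2).1, ?_⟩, fun a => ((h a.1).some a.2).2.1,
    fun a => ((h a.1).some a.2).2.2⟩
  rintro ⟨k, j⟩ ⟨k', j'⟩ hkk
  have h1 := ((h k).some j).2.2
  have h2 := ((h k').some j').2.2
  simp only at hkk
  rw [hkk, h2] at h1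
  subst h1
  exact congrArg _ ((h _).some.injective (Subtype.ext hkk))

/-- The sockets of the check nodes chosen by `f`, listed like the choices made in one round. -/
def newSockets {m : ↥(Finset.Icc 2 P.natDegree) → ℕ} (f : RoundCheck P m ↪ Fin M)
    (hf : ∀ a, e.deg (f a) = a.1) : (Σ a : RoundCheck P m, Fin a.1) ↪ e.Socket :=
  ⟨fun x => ⟨f x.1, Fin.cast (hf x.1).symm x.2⟩, by
    rintro ⟨a, j⟩ ⟨a', j'⟩ hxy
    have h1 : a = a' := f.injective (congrArg Sigma.fst hxy)
    subst h1
    have h2 := eq_of_heq (Sigma.mk.inj hxy).2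
    have h3 : j = j' := by simpa using h2
    rw [h3]⟩

lemma card_choices_le (hP : IsDegreeSequence P) {γ η : ℝ} (m : ↥(Finset.Icc 2 P.natDegree) → ℕ)
    (hm : ∀ k, |(m k : ℝ) - n * roundMean P γ k| ≤ η * (n * roundMean P γ k)) :
    (Fintype.card (Σ a : RoundCheck P m, Fin a.1) : ℝ) ≤ n * (γ * (1 + η)) := by
  have h1 : (Fintype.card (Σ a : RoundCheck P m, Fin a.1) : ℝ) =
      ∑ k : ↥(Finset.Icc 2 P.natDegree), (m k : ℝ) * (k : ℕ) := by
    rw [Fintype.card_sigma]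
    simp only [Fintype.card_fin]
    rw [Fintype.sum_sigma]
    simp
  rw [h1]
  calc ∑ k : ↥(Finset.Icc 2 P.natDegree), (m k : ℝ) * (k : ℕ)
      ≤ ∑ k : ↥(Finset.Icc 2 P.natDegree), n * (1 + η) * (roundMean P γ k * (k : ℕ)) := by
        refine Finset.sum_le_sum fun k _ => ?_
        have := (abs_le.1 (hm k)).2
        have h2 : (m k : ℝ) ≤ n * (1 + η) * roundMean P γ k := by linarith
        calc (m k : ℝ) * (k : ℕ) ≤ n * (1 + η) * roundMean P γ k * (k : ℕ) := by gcongr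
          _ = _ := by ring
    _ = n * (γ * (1 + η)) := by
        rw [← Finset.mul_sum, sum_roundMean_mul hP]
        ring

lemma sum_free_update (s : State n) (t : ℕ) (m : ↥(Finset.Icc 2 P.natDegree) → ℕ)
    (c : RoundChoice n P m) : ∑ i, ((s.update t m c).free i : ℝ) =
      ∑ i, (s.free i : ℝ) - Fintype.card (Σ a : RoundCheck P m, Fin a.1) := by
  have h : Fintype.card (Σ a : RoundCheck P m, Fin a.1) =
      ∑ i, ((Finset.univ : Finset (Σ a : RoundCheck P m, Fin a.1)).filter
        fun x => c x.1 x.2 = i).card := by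
    rw [← Finset.card_univ]
    exact Finset.card_eq_sum_card_fiberwise fun _ _ => Finset.mem_coe.2 (Finset.mem_univ _)
  rw [h, Nat.cast_sum, ← Finset.sum_sub_distrib]
  refine Finset.sum_congr rfl fun i _ => ?_
  simp [State.update]

/-- The relation is kept by a round with few differences. -/
lemma RoundInv.update {γ η : ℝ} (hP : IsDegreeSequence P) {t : ℕ} {s : State n}
    {B : Finset (Fin M)} {σ₀ σ : d.Socket ≃ e.Socket} (h : RoundInv γ η t s B σ₀)
    (m : ↥(Finset.Icc 2 P.natDegree) → ℕ)
    (hm : ∀ k, |(m k : ℝ) - n * roundMean P γ k| ≤ η * (n * roundMean P γ k))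
    (f : RoundCheck P m ↪ Fin M) (hfB : ∀ a, f a ∉ B) (hf : ∀ a, e.1 (f a) = a.1)
    (hσ : ∀ r ∈ socketsOf e B, σ.symm r = σ₀.symm r) (c : RoundChoice n P m)
    (hf' : ∀ a, e.deg (f a) = a.1)
    (hc : (((Finset.univ : Finset (Σ a : RoundCheck P m, Fin a.1)).filter
        fun x => (σ.symm ⟨f x.1, Fin.cast (hf' x.1).symm x.2⟩).1 ≠ c x.1 x.2).card : ℝ) ≤
      3 * (min 1 ((2 * diffBound (meanDegree Λ) (γ * (1 + η)) t + γ * (1 + η)) /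
        (meanDegree Λ - γ * (1 + η) * t)) * (n * (γ * (1 + η))))) :
    RoundInv γ η (t + 1) (s.update t m c) (B ∪ Finset.univ.map f) σ := by
  classical
  have hdisj : Disjoint B (Finset.univ.map f) := by
    rw [Finset.disjoint_right]
    intro x hx
    obtain ⟨y, -, rfl⟩ := Finset.mem_map.1 hx
    exact hfB y
  refine ⟨checks_update_lt s t h.names m c, ?_, ?_, ?_⟩
  · rw [sum_free_update]
    have h1 := h.total
    have h2 := card_choices_le (n := n) hP m hm
    push_cast
    linarith
  · intro k
    have hcard : ((B ∪ Finset.univ.map f).filter fun a => e.1 a = k).card =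
        (B.filter fun a => e.1 a = k).card + m k := by
      rw [Finset.filter_union, Finset.card_union_of_disjoint
        (Finset.disjoint_filter_filter hdisj), Finset.filter_map, Finset.card_map]
      congr 1
      have : (Finset.univ.filter ((fun a => e.1 a = k) ∘ f)) =
          (Finset.univ : Finset (Fin (m k))).map ⟨Sigma.mk k, sigma_mk_injective⟩ := by
        ext ⟨k', j⟩
        simp only [Finset.mem_filter, Finset.mem_univ, true_and, Finset.mem_map,
          Function.Embedding.coeFn_mk, Function.comp_apply, hf]
        constructor
        · rintro rfl
          exact ⟨j, rfl⟩
        · rintro ⟨j', h⟩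
          exact (congrArg Sigma.fst h).symm
      rw [this, Finset.card_map, Finset.card_univ, Fintype.card_fin]
    rw [hcard]
    have h1 := abs_le.1 (h.card_class k)
    have h2 := abs_le.1 (hm k)
    push_cast
    rw [abs_le]
    constructor <;> linarith [h1.1, h1.2, h2.1, h2.2]
  · obtain ⟨W, hW, hnear, hfree⟩ := h.near
    let r := newSockets f hf'
    have hrB : ∀ x, r x ∉ socketsOf e B := fun x hx => hfB _ (mem_socketsOf.1 hx)
    have hsock : socketsOf e (B ∪ Finset.univ.map f) = socketsOf e B ∪ Finset.univ.map r := by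
      ext ⟨a, j⟩
      rw [mem_socketsOf, Finset.mem_union, Finset.mem_union, mem_socketsOf]
      refine or_congr_right ?_
      constructor
      · intro ha
        obtain ⟨b, -, rfl⟩ := Finset.mem_map.1 ha
        exact Finset.mem_map.2 ⟨⟨b, Fin.cast (hf' b) j⟩, Finset.mem_univ _, rfl⟩
      · intro ha
        obtain ⟨b, -, hb⟩ := Finset.mem_map.1 ha
        exact Finset.mem_map.2 ⟨b.1, Finset.mem_univ _, congrArg Sigma.fst hb⟩
    -- One counter serves both purposes: a differing socket spoils at most one check node and shifts
    -- the free counts by at most two.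
    refine ⟨W + ((Finset.univ : Finset (Σ a : RoundCheck P m, Fin a.1)).filter
        fun x => (σ.symm (r x)).1 ≠ c x.1 x.2).card, ?_, ?_, ?_⟩
    · rw [diffBound]
      push_cast
      refine (add_le_add hW hc).trans (le_of_eq ?_)
      ring
    · rw [functionNodes_update s t h.names m c]
      have hval : (B ∪ Finset.univ.map f).val = B.val + (Finset.univ.map f).val := by
        rw [← Finset.disjUnion_eq_union _ _ hdisj]
        rfl
      rw [hval, Multiset.map_add]
      refine NearBy.add ?_ (nearBy_round σ m c f hf')
      have hB : B.val.map (socketNbhd σ) = B.val.map (socketNbhd σ₀) := by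
        refine Multiset.map_congr rfl fun a ha => ?_
        refine Multiset.map_congr rfl fun j _ => ?_
        rw [hσ ⟨a, j⟩ (mem_socketsOf.2 (by simpa using ha))]
      rwa [hB]
    · rw [hsock]
      refine (sum_natAbs_free_update_le Sigma.fst (socketsOf e B) σ r hrB s.free
        (fun x => c x.1 x.2)).trans ?_
      rw [freeCount_eq _ hσ, mul_add]
      exact Nat.add_le_add_right hfree _

end Round

/-! ### The probability that a round keeps the relation -/

section Round

variable {n M : ℕ} {Λ P : ℝ[X]} {d : NodePartition n Λ} {e : NodePartition M P}

lemma RoundInv.le_sum_toNat {γ η : ℝ} {t : ℕ} {s : State n} {B : Finset (Fin M)}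
    {σ : d.Socket ≃ e.Socket} (h : RoundInv γ η t s B σ) :
    n * (meanDegree Λ - γ * (1 + η) * t) ≤ ((∑ i, (s.free i).toNat : ℕ) : ℝ) := by
  refine h.total.trans ?_
  push_cast
  refine Finset.sum_le_sum fun i _ => ?_
  exact_mod_cast Int.self_le_toNat (s.free i)

lemma State.tsum_weight {n : ℕ} (s : State n) :
    ∑' i, s.weight i = ((∑ i, (s.free i).toNat : ℕ) : ℝ≥0∞) := by
  rw [tsum_fintype]
  push_cast
  rfl

lemma sum_natAbs_toNat_sub_le {V : Type} [Fintype V] (a : V → ℤ) (f : V → ℕ) :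
    ∑ v, (((a v).toNat : ℤ) - f v).natAbs ≤ ∑ v, (a v - f v).natAbs :=
  Finset.sum_le_sum fun v _ => by omega

lemma ENNReal.ofReal_exp_le_pow (W : ℕ) : ENNReal.ofReal (Real.exp W) ≤ 3 ^ W := by
  rw [← Real.exp_one_pow, ENNReal.ofReal_pow (Real.exp_pos 1).le]
  gcongr
  rw [ENNReal.ofReal_le_iff_le_toReal (by simp)]
  simpa using Real.exp_one_lt_three.le

/-- A bound for the tails from exponential moments. -/
lemma CoupledCost.tail {X Y : Type} {μ : PMF X} {ν : PMF Y} {W : X × Y → ℕ} {q y : ℝ} {K : ℕ}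
    (hq : 0 ≤ q) (hK : q * K ≤ y) (hy : 0 < y) {Z : X × Y → Prop} [DecidablePred Z]
    (h : CoupledCost μ ν (fun z => 3 ^ W z) ((1 + 2 * ENNReal.ofReal q) ^ K))
    (hZ : ∀ x ∈ μ.support, ∀ c ∈ ν.support, (W (x, c) : ℝ) ≤ 3 * y → Z (x, c)) :
    CoupledCost μ ν (fun z => if Z z then 0 else 1) (ENNReal.ofReal (1 / y)) := by
  refine (h.affine 0 (ENNReal.ofReal (Real.exp (-(3 * y))))).mono ?_ ?_
  · intro x hx c hc
    split_ifs with hz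
    · exact zero_le
    have hW : 3 * y < W (x, c) := by
      by_contra! hle
      exact hz (hZ x hx c hc hle)
    rw [zero_add]
    calc (1 : ℝ≥0∞) ≤ ENNReal.ofReal (Real.exp (-(3 * y)) * Real.exp (W (x, c))) := by
          rw [← Real.exp_add, ENNReal.one_le_ofReal, Real.one_le_exp_iff]
          linarith
      _ ≤ _ := by
          rw [ENNReal.ofReal_mul (Real.exp_pos _).le]
          gcongr
          exact ENNReal.ofReal_exp_le_pow _
  · have h1 : (1 + 2 * ENNReal.ofReal q) ^ K = ENNReal.ofReal ((1 + 2 * q) ^ K) := by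
      rw [ENNReal.ofReal_pow (by positivity), ENNReal.ofReal_add zero_le_one (by positivity),
        ENNReal.ofReal_mul zero_le_two]
      simp
    rw [zero_add, h1, ← ENNReal.ofReal_mul (Real.exp_pos _).le]
    refine ENNReal.ofReal_le_ofReal ?_
    -- Since `(1 + 2q)^K ≤ exp(2qK) ≤ exp(2y)`, Markov's inequality at level `3y` leaves `exp(-y)`;
    -- the weaker `1 / y` suffices.
    calc Real.exp (-(3 * y)) * (1 + 2 * q) ^ K
        ≤ Real.exp (-(3 * y)) * Real.exp (2 * q) ^ K := by
          gcongr
          linarith [Real.add_one_le_exp (2 * q)]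
      _ = Real.exp (-(3 * y) + 2 * (q * K)) := by
          rw [← Real.exp_nat_mul, ← Real.exp_add]
          ring_nf
      _ ≤ Real.exp (-y) := by
          rw [Real.exp_le_exp]
          linarith
      _ ≤ 1 / y := by
          rw [Real.exp_neg, ← one_div]
          exact one_div_le_one_div_of_le hy (by linarith [Real.add_one_le_exp y])

open Classical in
/-- One round, for given numbers of new check nodes: the relation is kept with high probability. -/
lemma coupledCost_round {γ η : ℝ} (hP : IsDegreeSequence P) (hγ : 0 < γ) (hη : 0 < η) (hn : 0 < n)
    {t : ℕ} (ht : γ * (1 + η) * (t + 1) ≤ meanDegree Λ)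
    (hroom : n * meanDegree Λ = M * meanDegree P)
    {s : State n} {B : Finset (Fin M)} {σ₀ : d.Socket ≃ e.Socket} (h : RoundInv γ η t s B σ₀)
    (m : ↥(Finset.Icc 2 P.natDegree) → ℕ)
    (hm : ∀ k, |(m k : ℝ) - n * roundMean P γ k| ≤ η * (n * roundMean P γ k))
    (hw : ∑' i, s.weight i ≠ 0) :
    ∃ B', socketsOf e B ⊆ socketsOf e B' ∧
      CoupledCost (matchingLaw (socketsOf e B) σ₀)
        (productPMF fun a : RoundCheck P m => productPMF fun _ : Fin a.1 =>
          PMF.normalize s.weight hw s.tsum_weight_ne_top)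
        (fun z => if RoundInv γ η (t + 1) (s.update t m z.2) B' z.1 then 0 else 1)
        (ENNReal.ofReal (1 / (min 1 (γ * (1 + η) / meanDegree Λ) * (n * (γ * (1 + η)))))) := by
  have hg : 0 < γ * (1 + η) := by positivity
  obtain ⟨g, hgdef⟩ : ∃ g, g = γ * (1 + η) := ⟨_, rfl⟩
  have hn' : (0 : ℝ) < n := by exact_mod_cast hn
  have hP0 := hP.meanDegree_pos
  -- After this round at most `(t + 1)(1 + η)` times the mean number of nodes of degree `k` per
  -- round is used, and `ht` keeps this below `M P_k`.
  obtain ⟨f, hfB, hf⟩ := exists_new_checks (e := e) B m (by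
    intro k
    have h1 := (abs_le.1 (h.card_class k)).2
    have h2 := (abs_le.1 (hm k)).2
    have h3 : (M : ℝ) * P.coeff k = n * P.coeff k / meanDegree P * meanDegree Λ := by
      rw [div_mul_eq_mul_div, eq_div_iff hP0.ne']
      linear_combination (-P.coeff k) * hroom
    have h4 : n * P.coeff k / meanDegree P * (γ * (1 + η) * (t + 1)) ≤
        n * P.coeff k / meanDegree P * meanDegree Λ :=
      mul_le_mul_of_nonneg_left ht (div_nonneg (mul_nonneg hn'.le (hP.nonneg k)) hP0.le)
    have h5 : n * P.coeff k / meanDegree P * (γ * (1 + η) * (t + 1)) =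
        (t + 1) * ((1 + η) * (n * roundMean P γ k)) := by
      rw [roundMean]
      ring
    rw [h3]
    linarith)
  have hf' : ∀ a, e.deg (f a) = a.1 := fun a => congrArg Subtype.val (hf a)
  refine ⟨B ∪ Finset.univ.map f, fun x hx => mem_socketsOf.2
    (Finset.mem_union_left _ (mem_socketsOf.1 hx)), ?_⟩
  obtain ⟨W, hW, -, hfree⟩ := h.near
  have hA := h.le_sum_toNat
  have hr : γ * (1 + η) ≤ meanDegree Λ - γ * (1 + η) * t := by linarith
  have hx := diffBound_nonneg hg (t := t) (D := meanDegree Λ) (by linarith)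
  have hupd := fun σ hσ c hc => h.update hP m hm f hfB hf (σ := σ) hσ c hf' hc
  have hK := card_choices_le (n := n) hP m hm
  rw [← hgdef] at hA hr hx hupd hW hK hg ⊢
  set x := diffBound (meanDegree Λ) g t
  set q : ℝ := min 1 ((2 * x + g) / (meanDegree Λ - g * t)) with hq
  have hr0 : 0 < meanDegree Λ - g * t := hg.trans_le hr
  -- A lower bound for `q` independent of `t`: the tail bound `1 / (q n g)` becomes uniform over the
  -- rounds.
  have hq0 : min 1 (g / meanDegree Λ) ≤ q := by
    refine min_le_min le_rfl ?_
    have : (0 : ℝ) ≤ g * t := by positivity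
    gcongr <;> linarith
  have hD : 0 < meanDegree Λ := by
    have : (0 : ℝ) ≤ g * t := by positivity
    linarith
  have hqpos : 0 < q := lt_of_lt_of_le (lt_min one_pos (by positivity)) hq0
  have hApos : 0 < ∑ i, (s.free i).toNat := by
    have : (0 : ℝ) < ((∑ i, (s.free i).toNat : ℕ) : ℝ) := lt_of_lt_of_le (by positivity) hA
    exact_mod_cast this
  let r := newSockets f hf'
  have hrB : ∀ x, r x ∉ socketsOf e B := fun x hx => hfB _ (mem_socketsOf.1 hx)
  have hcost := coupledCost_matchingLaw_productPMF_fintype (Sigma.fst : d.Socket → Fin n)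
    (fun i => (s.free i).toNat)
    (PMF.normalize s.weight hw s.tsum_weight_ne_top) hApos (by
      intro i
      rw [PMF.normalize_apply, s.tsum_weight, div_eq_mul_inv]
      rfl) (ENNReal.ofReal q) (socketsOf e B) σ₀ r hrB (by
      rcases le_total 1 ((2 * x + g) / (meanDegree Λ - g * t)) with h1 | h1
      · left
        rw [hq, min_eq_left h1, ENNReal.ofReal_one]
      · right
        rw [hq, min_eq_right h1, ← ENNReal.ofReal_natCast, ← ENNReal.ofReal_natCast,
          ← ENNReal.ofReal_mul (by positivity)]
        refine ENNReal.ofReal_le_ofReal ?_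
        have h2 : ((∑ i, (((s.free i).toNat : ℤ) -
            freeCount Sigma.fst (socketsOf e B) σ₀ i).natAbs : ℕ) : ℝ) ≤ 2 * W := by
          exact_mod_cast (sum_natAbs_toNat_sub_le s.free _).trans hfree
        rw [Nat.cast_add]
        calc _ ≤ n * (2 * x + g) := by linarith
          _ = (2 * x + g) / (meanDegree Λ - g * t) * (n * (meanDegree Λ - g * t)) := by
            field_simp
          _ ≤ _ := by gcongr)
  rw [← productPMF_curry, ← PMF.map_id (matchingLaw (socketsOf e B) σ₀)]
  refine CoupledCost.map ?_
  refine (CoupledCost.tail (y := q * (n * g)) hqpos.le (by gcongr) (by positivity) hcost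
    (Z := fun z : (d.Socket ≃ e.Socket) × ((Σ a : RoundCheck P m, Fin a.1) → Fin n) =>
      RoundInv γ η (t + 1) (s.update t m fun a j => z.2 ⟨a, j⟩)
        (B ∪ Finset.univ.map f) z.1) ?_).mono_right ?_
  · intro σ hσ c _ hc
    rw [mem_support_matchingLaw] at hσ
    exact hupd σ hσ _ hc
  · refine ENNReal.ofReal_le_ofReal ?_
    refine one_div_le_one_div_of_le ?_ (by gcongr)
    have : 0 < min 1 (g / meanDegree Λ) := lt_min one_pos (by positivity)
    positivity

end Round

/-! ### The rounds of the multi-Poisson ensemble -/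

/-- The state after `k` more rounds, if the state after `t` rounds is `s`. -/
def runFrom {n : ℕ} (P : ℝ[X]) (γ : ℝ) : ℕ → ℕ → State n → PMF (Option (State n))
  | _, 0, s => PMF.pure (some s)
  | t, k + 1, s => (nextState P γ t s).bind fun o =>
      o.elim (PMF.pure none) (runFrom P γ (t + 1) k)

/-- `stateAfter` splits off the last round, `runFrom` the first. The latter form suits an induction
over the remaining rounds, conditionally on the current state. -/
lemma stateAfter_add {n : ℕ} {Λ : ℝ[X]} (P : ℝ[X]) (γ : ℝ) (d : NodePartition n Λ) (k : ℕ) :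
    ∀ t, stateAfter P γ d (t + k) =
      (stateAfter P γ d t).bind fun o => o.elim (PMF.pure none) (runFrom P γ t k) := by
  induction k with
  | zero =>
    intro t
    have : (fun o : Option (State n) => o.elim (PMF.pure none) (runFrom P γ t 0)) = PMF.pure := by
      funext o
      cases o <;> rfl
    rw [this, PMF.bind_pure, add_zero]
  | succ k ih =>
    intro t
    rw [show t + (k + 1) = t + 1 + k by ring, ih, stateAfter, PMF.bind_bind]
    congr 1
    funext o
    cases o with
    | none => rw [PMF.pure_bind]; rfl
    | some s => rfl

lemma stateAfter_eq_runFrom {n : ℕ} {Λ : ℝ[X]} (P : ℝ[X]) (γ : ℝ) (d : NodePartition n Λ) (k : ℕ) :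
    stateAfter P γ d k = runFrom P γ 0 k (State.init d) := by
  have h := stateAfter_add P γ d k 0
  rwa [zero_add, stateAfter, PMF.pure_bind] at h

lemma runFrom_succ {n : ℕ} (P : ℝ[X]) (γ : ℝ) (t k : ℕ) (s : State n)
    (hw : ∑' i, s.weight i ≠ 0) : runFrom P γ t (k + 1) s =
      (productPMF fun k : ↥(Finset.Icc 2 P.natDegree) =>
          (poissonMeasure (n * roundMean P γ k).toNNReal).toPMF).bind fun m =>
        (productPMF fun a : RoundCheck P m => productPMF fun _ : Fin a.1 =>
          PMF.normalize s.weight hw s.tsum_weight_ne_top).bind fun c =>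
            runFrom P γ (t + 1) k (s.update t m c) := by
  have h : ∀ k : ↥(Finset.Icc 2 P.natDegree),
      n * γ * P.coeff k / meanDegree P = n * roundMean P γ k := fun k => by
    rw [roundMean]
    ring
  rw [runFrom, nextState, dif_neg hw, PMF.bind_bind]
  simp only [h, PMF.bind_map]
  rfl

lemma PMF.tsum_mul_ite_le {X : Type} (p : PMF X) {Z : X → Prop} [DecidablePred Z] (c : ℝ≥0∞) :
    ∑' x, p x * (if Z x then c else 1) ≤ c + p.toOuterMeasure {x | ¬ Z x} := by
  rw [PMF.toOuterMeasure_apply]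
  calc ∑' x, p x * (if Z x then c else 1)
      ≤ ∑' x, (p x * c + {x | ¬ Z x}.indicator p x) := by
        refine ENNReal.tsum_le_tsum fun x => ?_
        by_cases hx : Z x
        · simp [hx]
        · simp [hx, Set.indicator]
    _ = _ := by rw [ENNReal.tsum_add, ENNReal.tsum_mul_right, PMF.tsum_coe, one_mul]

/-! ### Composition of the rounds -/

section

variable {n M : ℕ} {Λ P : ℝ[X]} {d : NodePartition n Λ} {e : NodePartition M P}

lemma sum_card_class (B : Finset (Fin M)) :
    ∑ k, (B.filter fun a => e.1 a = k).card = B.card :=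
  (Finset.card_eq_sum_card_fiberwise fun _ _ => Finset.mem_coe.2 (Finset.mem_univ _)).symm

/-- At most `W` nodes are removed, at most `W` are added in their place, and the check nodes outside
`B` are added. The lower bounds on the classes of `B` control the number of the latter. -/
lemma RoundInv.mem_closeEvent {γ η : ℝ} (hP : IsDegreeSequence P) {T : ℕ} {s : State n}
    {B : Finset (Fin M)} {σ₀ σ : d.Socket ≃ e.Socket} (h : RoundInv γ η T s B σ₀)
    (hσ : ∀ r ∈ socketsOf e B, σ.symm r = σ₀.symm r) {b : ℝ}
    (hb : 2 * (n * diffBound (meanDegree Λ) (γ * (1 + η)) T) +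
      (M - T * (n * (γ / meanDegree P)) * (1 - η)) < b) :
    (socketGraph d e σ, some s.graph) ∈ closeEvent n M b := by
  classical
  obtain ⟨W, hW, hnear, -⟩ := h.near
  refine ⟨s.graph, rfl, ?_⟩
  have hB : B.val.map (socketNbhd σ₀) = B.val.map (socketNbhd σ) := by
    refine Multiset.map_congr rfl fun a ha => ?_
    refine Multiset.map_congr rfl fun j _ => ?_
    rw [hσ ⟨a, j⟩ (mem_socketsOf.2 (by simpa using ha))]
  have hval : (Finset.univ : Finset (Fin M)).val = B.val + Bᶜ.val := by
    rw [← Finset.union_compl B, ← Finset.disjUnion_eq_union _ _ disjoint_compl_right]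
    rfl
  rw [hB] at hnear
  obtain ⟨r, hr, hre⟩ := hnear.rewires (Bᶜ.val.map (socketNbhd σ))
  refine ⟨r, ?_, ?_⟩
  · have h1 : (B.card : ℝ) + (Bᶜ.card : ℝ) = M := by
      exact_mod_cast (Finset.card_add_card_compl B).trans (Fintype.card_fin M)
    have h2 : T * (n * (γ / meanDegree P)) * (1 - η) ≤ B.card := by
      rw [← sum_roundMean hP, ← sum_card_class (e := e) B, Finset.mul_sum, Finset.mul_sum,
        Finset.sum_mul, Nat.cast_sum]
      refine Finset.sum_le_sum fun k _ => ?_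
      have := (abs_le.1 (h.card_class k)).1
      linarith
    rw [Multiset.card_map] at hr
    have h3 : (r : ℝ) ≤ 2 * W + Bᶜ.card := by exact_mod_cast hr
    linarith
  · rw [functionNodes_socketGraph, hval, Multiset.map_add]
    exact hre

open Classical in
/-- Coupling of the remaining rounds with the remaining part of the random matching. -/
lemma coupledCost_runFrom {γ η : ℝ} (hP : IsDegreeSequence P) (hγ : 0 < γ)
    (hη : 0 < η) (hn : 0 < n) {T : ℕ} (hT : γ * (1 + η) * T ≤ meanDegree Λ)
    (hroom : n * meanDegree Λ = M * meanDegree P) {b : ℝ}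
    (hb : 2 * (n * diffBound (meanDegree Λ) (γ * (1 + η)) T) +
      (M - T * (n * (γ / meanDegree P)) * (1 - η)) < b) {ε₁ ε₂ : ℝ≥0∞}
    (hε₁ : ENNReal.ofReal (∑ k : ↥(Finset.Icc 2 P.natDegree),
      1 / (η ^ 2 * (n * roundMean P γ k))) ≤ ε₁)
    (hε₂ : ENNReal.ofReal
      (1 / (min 1 (γ * (1 + η) / meanDegree Λ) * (n * (γ * (1 + η))))) ≤ ε₂) (k : ℕ) :
    ∀ (t : ℕ) (s : State n) (B : Finset (Fin M)) (σ₀ : d.Socket ≃ e.Socket), t + k = T →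
      RoundInv γ η t s B σ₀ →
      CoupledCost (matchingLaw (socketsOf e B) σ₀) (runFrom P γ t k s)
        (fun z => if (socketGraph d e z.1, z.2.map State.graph) ∈ closeEvent n M b then 0 else 1)
        (k * (ε₁ + ε₂)) := by
  induction k with
  | zero =>
    rintro t s B σ₀ rfl h
    refine coupledCost_of_le _ _ fun σ hσ o ho => ?_
    rw [runFrom, PMF.mem_support_pure_iff] at ho
    rw [mem_support_matchingLaw] at hσ
    rw [if_pos]
    · exact zero_le
    · rw [ho]
      exact h.mem_closeEvent hP hσ hb
  | succ k ih =>
    intro t s B σ₀ ht h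
    have hg : 0 < γ * (1 + η) := by positivity
    have htT : γ * (1 + η) * (t + 1) ≤ meanDegree Λ := by
      refine le_trans (mul_le_mul_of_nonneg_left ?_ hg.le) hT
      rw [← ht]
      push_cast
      linarith [(Nat.cast_nonneg k : (0 : ℝ) ≤ k)]
    have hw : ∑' i, s.weight i ≠ 0 := by
      rw [s.tsum_weight]
      have h1 := h.le_sum_toNat
      have hn' : (0 : ℝ) < n := by exact_mod_cast hn
      have h2 : (0 : ℝ) < n * (meanDegree Λ - γ * (1 + η) * t) :=
        mul_pos hn' (by linarith)
      have h3 := h2.trans_le h1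
      exact_mod_cast h3.ne'
    rw [runFrom_succ P γ t k s hw]
    have hmean : ∀ k : ↥(Finset.Icc 2 P.natDegree), 0 ≤ n * roundMean P γ k := fun k =>
      mul_nonneg (Nat.cast_nonneg n) (roundMean_nonneg hP hγ k)
    -- The matching does not depend on the Poisson numbers; a constant bind gives both sides the
    -- same first random choice.
    rw [← PMF.bind_const (productPMF fun k : ↥(Finset.Icc 2 P.natDegree) =>
          (poissonMeasure (n * roundMean P γ k).toNNReal).toPMF)
        (matchingLaw (socketsOf e B) σ₀)]
    refine (coupledCost_bind_same _ (φ := fun m =>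
      if ∀ k : ↥(Finset.Icc 2 P.natDegree),
        |(m k : ℝ) - n * roundMean P γ k| ≤ η * (n * roundMean P γ k)
        then k * (ε₁ + ε₂) + ε₂ else 1) ?_).mono_right ?_
    · intro m _
      split_ifs with hm
      · obtain ⟨B', hBB', hcost⟩ := coupledCost_round hP hγ hη hn htT hroom h m hm hw
        -- The round reveals the sockets of `B'`. The rest of the matching is resampled
        -- conditionally on them, as the induction hypothesis requires.
        rw [matchingLaw_bind hBB' σ₀]
        refine (CoupledCost.bind (hcost.affine (k * (ε₁ + ε₂)) 1) fun σ₁ _ c _ => ?_).mono_right ?_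
        · by_cases hinv : RoundInv γ η (t + 1) (s.update t m c) B' σ₁
          · simp only [if_pos hinv, mul_zero, add_zero]
            exact ih (t + 1) _ B' σ₁ (by omega) hinv
          · simp only [if_neg hinv, mul_one]
            refine coupledCost_of_le _ _ fun _ _ _ _ => ?_
            refine le_trans ?_ (le_add_self : (1 : ℝ≥0∞) ≤ k * (ε₁ + ε₂) + 1)
            split_ifs <;> simp
        · rw [one_mul]
          gcongr
      · refine coupledCost_of_le _ _ fun _ _ _ _ => ?_
        split_ifs <;> simp
    · refine (PMF.tsum_mul_ite_le _ _).trans ?_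
      have := (productPMF_poisson_le (fun k : ↥(Finset.Icc 2 P.natDegree) => n * roundMean P γ k)
        hmean hη).trans hε₁
      refine (add_le_add_right this _).trans (le_of_eq ?_)
      push_cast
      ring

lemma roundInv_init (γ η : ℝ) (hΛ : IsDegreeSequence Λ) (σ : d.Socket ≃ e.Socket) :
    RoundInv γ η 0 (State.init d) (∅ : Finset (Fin M)) σ := by
  refine ⟨by simp [State.init], ?_, by simp, 0, by simp [diffBound], ?_, ?_⟩
  · have h := NodePartition.card_socket hΛ d
    rw [Fintype.card_sigma] at h
    simp only [Fintype.card_fin, Nat.cast_sum] at h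
    simp [State.init, h]
  · exact NearBy.zero 0
  · refine le_of_eq (Finset.sum_eq_zero fun i _ => ?_)
    have h1 : freeCount Sigma.fst (socketsOf e (∅ : Finset (Fin M))) σ i = d.deg i := by
      classical
      have h2 := congrArg Finset.card (show (Finset.univ : Finset d.Socket).filter
        (fun l => l.1 = i) = (Finset.univ : Finset (Fin (d.deg i))).map
          ⟨Sigma.mk i, sigma_mk_injective⟩ from Finset.val_injective (filter_fst_sigma_val i))
      rw [Finset.card_map, Finset.card_univ, Fintype.card_fin] at h2
      rw [← h2, freeCount]
      congr 1
      ext l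
      simp [unmatched, mem_socketsOf]
    rw [h1]
    simp [State.init]

end

/-! ### The coupling of the ensembles -/

open Classical in
lemma coupledCost_ensembles {Λ P : ℝ[X]} (hΛ : IsDegreeSequence Λ) (hP : IsDegreeSequence P)
    {n : ℕ} (h : Admissible Λ P n) (hn : 0 < n) {γ η : ℝ} (hγ : 0 < γ) (hη : 0 < η)
    (hT : γ * (1 + η) * numRounds Λ γ ≤ meanDegree Λ) {b : ℝ}
    (hb : 2 * (n * diffBound (meanDegree Λ) (γ * (1 + η)) (numRounds Λ γ)) +
      (numChecks n Λ P - numRounds Λ γ * (n * (γ / meanDegree P)) * (1 - η)) < b) {ε₁ ε₂ : ℝ≥0∞}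
    (hε₁ : ENNReal.ofReal (∑ k : ↥(Finset.Icc 2 P.natDegree),
      1 / (η ^ 2 * (n * roundMean P γ k))) ≤ ε₁)
    (hε₂ : ENNReal.ofReal
      (1 / (min 1 (γ * (1 + η) / meanDegree Λ) * (n * (γ * (1 + η))))) ≤ ε₂) :
    CoupledCost (standardEnsemble hΛ hP h) (multiPoissonEnsemble hΛ P γ h.left)
      (fun z => if z ∈ closeEvent n (numChecks n Λ P) b then 0 else 1)
      (numRounds Λ γ * (ε₁ + ε₂)) := by
  have hroom : n * meanDegree Λ = numChecks n Λ P * meanDegree P := by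
    rw [h.numChecks_eq, div_mul_cancel₀ _ hP.meanDegree_pos.ne']
  unfold standardEnsemble multiPoissonEnsemble
  have hconst : ∀ {X : Type} (p : PMF X), ∑' x, p x * (numRounds Λ γ * (ε₁ + ε₂)) =
      numRounds Λ γ * (ε₁ + ε₂) := fun p => by
    rw [ENNReal.tsum_mul_right, PMF.tsum_coe, one_mul]
  refine (coupledCost_bind_same _ (φ := fun _ => numRounds Λ γ * (ε₁ + ε₂)) fun d _ =>
    ?_).mono_right (hconst _).le
  have := hP.nonempty h.right
  rw [← PMF.bind_const (PMF.uniformOfFintype (NodePartition (numChecks n Λ P) P))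
    (PMF.map _ (stateAfter P γ d (numRounds Λ γ)))]
  refine (coupledCost_bind_same _ (φ := fun _ => numRounds Λ γ * (ε₁ + ε₂)) fun e _ =>
    ?_).mono_right (hconst _).le
  have hne := h.nonempty_equiv hΛ hP d e
  obtain ⟨σ₀⟩ := id hne
  refine CoupledCost.map ?_
  have hempty : socketsOf e ∅ = ∅ := by
    ext x
    simp [mem_socketsOf]
  rw [stateAfter_eq_runFrom, matchingLaw_empty σ₀, ← hempty]
  exact coupledCost_runFrom hP hγ hη hn hT hroom hb hε₁ hε₂ _ 0 _ ∅ σ₀ (zero_add _)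
    (roundInv_init γ η hΛ σ₀)

lemma IsDegreeSequence.one_le_meanDegree {Q : ℝ[X]} (hQ : IsDegreeSequence Q) :
    1 ≤ meanDegree Q := by
  rw [← hQ.sum_coeff_mul, ← hQ.sum_coeff]
  refine Finset.sum_le_sum fun l _ => le_mul_of_one_le_right (hQ.nonneg l) ?_
  exact_mod_cast le_trans one_le_two (Finset.mem_Icc.1 l.2).1

/-- Close couplings of the ensembles fail with probability `O(1 / n)`. -/
lemma exists_coupling {Λ P : ℝ[X]} (hΛ : IsDegreeSequence Λ) (hP : IsDegreeSequence P) {γ : ℝ}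
    (hγ : 0 < γ) (hγ1 : γ < 1) : ∃ C : ℝ, ∀ n : ℕ, ∀ h : Admissible Λ P n, 0 < n →
      ∃ π, IsCoupling π (standardEnsemble hΛ hP h) (multiPoissonEnsemble hΛ P γ h.left) ∧
        1 - ENNReal.ofReal (C / n) ≤ π.toOuterMeasure (closeEvent n (numChecks n Λ P)
          ((4 * (meanDegree Λ ^ 6 + 390) + 3 / meanDegree P + 1) * n * γ ^ (1 / 7 : ℝ))) := by
  classical
  have hD := hΛ.one_le_meanDegree
  have hD0 := hΛ.meanDegree_pos
  have hP0 := hP.meanDegree_pos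
  -- With this tolerance the fluctuations of all rounds together use at most `γ` extra sockets per
  -- variable node, exactly the reserve left by the `- 1` in `numRounds`.
  obtain ⟨η, hηdef⟩ : ∃ η, η = γ / meanDegree Λ := ⟨_, rfl⟩
  have hη : 0 < η := by rw [hηdef]; positivity
  have hηD : η * meanDegree Λ = γ := by rw [hηdef, div_mul_cancel₀ _ hD0.ne']
  have hη1 : η ≤ 1 := by rw [hηdef, div_le_one hD0]; linarith
  have hfloor : 1 ≤ ⌊meanDegree Λ / γ⌋₊ := by
    rw [Nat.one_le_floor_iff, one_le_div hγ]
    linarith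
  obtain ⟨T, hTdef⟩ : ∃ T, T = numRounds Λ γ := ⟨_, rfl⟩
  have hT1 : (T : ℝ) + 1 = ⌊meanDegree Λ / γ⌋₊ := by
    rw [hTdef, numRounds, Nat.cast_sub hfloor]
    simp
  have hTle : γ * (T + 1) ≤ meanDegree Λ := by
    rw [hT1, mul_comm]
    exact (le_div_iff₀ hγ).1 (Nat.floor_le (by positivity))
  have hTge : meanDegree Λ ≤ γ * (T + 2) := by
    have := (Nat.lt_floor_add_one (meanDegree Λ / γ)).le
    rw [← hT1, div_le_iff₀ hγ] at this
    linarith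
  have hT : γ * (1 + η) * T ≤ meanDegree Λ := by
    have : η * (γ * T) ≤ η * meanDegree Λ := mul_le_mul_of_nonneg_left (by linarith) hη.le
    linarith
  have hdiff := diffBound_le (D := meanDegree Λ) (g := γ * (1 + η)) (by positivity)
    (by nlinarith) hT
  have hpow : (γ * (1 + η)) ^ (1 / 7 : ℝ) ≤ 2 * γ ^ (1 / 7 : ℝ) := by
    rw [Real.mul_rpow hγ.le (by positivity), mul_comm]
    refine mul_le_mul_of_nonneg_right ?_ (by positivity)
    calc (1 + η) ^ (1 / 7 : ℝ) ≤ (1 + η) ^ (1 : ℝ) :=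
          Real.rpow_le_rpow_of_exponent_le (by linarith) (by norm_num)
      _ ≤ 2 := by rw [Real.rpow_one]; linarith
  have hγpow : γ ≤ γ ^ (1 / 7 : ℝ) := by
    calc γ = γ ^ (1 : ℝ) := (Real.rpow_one γ).symm
      _ ≤ _ := Real.rpow_le_rpow_of_exponent_ge hγ hγ1.le (by norm_num)
  have hγpow0 : 0 < γ ^ (1 / 7 : ℝ) := by positivity
  obtain ⟨C₁, hC₁⟩ : ∃ C₁, C₁ = ∑ k : ↥(Finset.Icc 2 P.natDegree),
    1 / (η ^ 2 * roundMean P γ k) := ⟨_, rfl⟩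
  obtain ⟨C₂, hC₂⟩ : ∃ C₂, C₂ =
    1 / (min 1 (γ * (1 + η) / meanDegree Λ) * (γ * (1 + η))) := ⟨_, rfl⟩
  have hC₁0 : 0 ≤ C₁ := by
    rw [hC₁]
    exact Finset.sum_nonneg fun k _ => one_div_nonneg.2
      (mul_nonneg (sq_nonneg _) (roundMean_nonneg hP hγ k))
  have hC₂0 : 0 ≤ C₂ := by rw [hC₂]; positivity
  -- The constant depends on `γ` but not on `n`: `C₁ / n` bounds the Poisson deviations of a round
  -- and `C₂ / n` an excess of differences.
  refine ⟨T * (C₁ + C₂), fun n h hn => ?_⟩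
  have hn' : (0 : ℝ) < n := by exact_mod_cast hn
  obtain ⟨π, hπ, hcost⟩ := coupledCost_ensembles hΛ hP h hn hγ hη (hTdef ▸ hT)
    (b := (4 * (meanDegree Λ ^ 6 + 390) + 3 / meanDegree P + 1) * n * γ ^ (1 / 7 : ℝ))
    (ε₁ := ENNReal.ofReal (C₁ / n)) (ε₂ := ENNReal.ofReal (C₂ / n)) (by
      rw [← hTdef, h.numChecks_eq]
      have h1 : n * meanDegree Λ / meanDegree P - T * (n * (γ / meanDegree P)) * (1 - η) ≤
          n * (3 / meanDegree P * γ) := by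
        -- The rounding of the number of rounds costs at most `2γ`, the Poisson tolerance at most
        -- another `γ`.
        have h2 : meanDegree Λ - T * γ * (1 - η) ≤ 3 * γ := by
          have : η * (γ * T) ≤ η * meanDegree Λ := mul_le_mul_of_nonneg_left (by linarith) hη.le
          linarith
        calc _ = n / meanDegree P * (meanDegree Λ - T * γ * (1 - η)) := by ring
          _ ≤ n / meanDegree P * (3 * γ) := by gcongr
          _ = _ := by ring
      have h3 : n * (3 / meanDegree P * γ) ≤ n * (3 / meanDegree P * γ ^ (1 / 7 : ℝ)) := by gcongr
      have h4 : n * diffBound (meanDegree Λ) (γ * (1 + η)) T ≤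
          n * ((meanDegree Λ ^ 6 + 390) * (2 * γ ^ (1 / 7 : ℝ))) := by
        gcongr
        exact hdiff.trans (by gcongr)
      have h5 : 0 < n * γ ^ (1 / 7 : ℝ) := by positivity
      linarith) (by
      refine ENNReal.ofReal_le_ofReal (le_of_eq ?_)
      rw [hC₁, Finset.sum_div]
      refine Finset.sum_congr rfl fun k _ => ?_
      rw [div_div]
      ring_nf) (by
      refine ENNReal.ofReal_le_ofReal (le_of_eq ?_)
      rw [hC₂, div_div]
      ring_nf)
  refine ⟨π, hπ, ?_⟩
  set E := closeEvent n (numChecks n Λ P)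
    ((4 * (meanDegree Λ ^ 6 + 390) + 3 / meanDegree P + 1) * n * γ ^ (1 / 7 : ℝ))
  rw [tsub_le_iff_right]
  have hε : (numRounds Λ γ * (ENNReal.ofReal (C₁ / n) + ENNReal.ofReal (C₂ / n)) : ℝ≥0∞) =
      ENNReal.ofReal (T * (C₁ + C₂) / n) := by
    rw [← ENNReal.ofReal_add (by positivity) (by positivity), ← hTdef, ← ENNReal.ofReal_natCast,
      ← ENNReal.ofReal_mul (by positivity)]
    congr 1
    ring
  rw [← hε]
  refine le_trans ?_ (add_le_add_right hcost _)
  rw [PMF.toOuterMeasure_apply, ← ENNReal.tsum_add, ← π.tsum_coe]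
  refine ENNReal.tsum_le_tsum fun z => ?_
  by_cases hz : z ∈ E <;> simp [hz, Set.indicator]

end TannerEnsembles

end

/-! ### The limit along admissible sizes -/

theorem mainTheorem3 (Λ P : Polynomial ℝ)
    (hΛ : TannerEnsembles.IsDegreeSequence Λ) (hP : TannerEnsembles.IsDegreeSequence P) :
    ∃ A b : ℝ, 0 < A ∧ 0 < b ∧ ∀ γ : ℝ, 0 < γ → γ < 1 →
      ∃ π : (n : {n : ℕ // TannerEnsembles.Admissible Λ P n}) →
          PMF (TannerEnsembles.TannerGraph (Fin n.1) (Fin (TannerEnsembles.numChecks n.1 Λ P)) ×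
            Option (TannerEnsembles.TannerGraph (Fin n.1) (ℕ × ℕ × ℕ))),
        (∀ n, TannerEnsembles.IsCoupling (π n)
          (TannerEnsembles.standardEnsemble hΛ hP n.2)
          (TannerEnsembles.multiPoissonEnsemble hΛ P γ n.2.left)) ∧
        Filter.Tendsto
          (fun n => (π n).toOuterMeasure
            (TannerEnsembles.closeEvent n.1 (TannerEnsembles.numChecks n.1 Λ P)
              (A * n.1 * γ ^ b)))
          (Filter.comap Subtype.val Filter.atTop) (nhds 1) := by
  have hP0 := hP.meanDegree_pos
  have hΛ0 := hΛ.meanDegree_pos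
  refine ⟨4 * (TannerEnsembles.meanDegree Λ ^ 6 + 390) + 3 / TannerEnsembles.meanDegree P + 1,
    1 / 7, by positivity, by norm_num, fun γ hγ hγ1 => ?_⟩
  obtain ⟨C, hC⟩ := TannerEnsembles.exists_coupling hΛ hP hγ hγ1
  have key : ∀ n : {n : ℕ // TannerEnsembles.Admissible Λ P n}, ∃ π,
      TannerEnsembles.IsCoupling π (TannerEnsembles.standardEnsemble hΛ hP n.2)
        (TannerEnsembles.multiPoissonEnsemble hΛ P γ n.2.left) ∧
      (0 < n.1 → 1 - ENNReal.ofReal (C / n.1) ≤ π.toOuterMeasure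
        (TannerEnsembles.closeEvent n.1 (TannerEnsembles.numChecks n.1 Λ P)
          ((4 * (TannerEnsembles.meanDegree Λ ^ 6 + 390) + 3 / TannerEnsembles.meanDegree P + 1) *
            n.1 * γ ^ (1 / 7 : ℝ)))) := by
    intro n
    -- A coupling is also owed for `n = 0`; any one will do, since the limit ignores it.
    rcases Nat.eq_zero_or_pos n.1 with hn | hn
    · obtain ⟨π, hπ⟩ := TannerEnsembles.exists_isCoupling
        (TannerEnsembles.standardEnsemble hΛ hP n.2)
        (TannerEnsembles.multiPoissonEnsemble hΛ P γ n.2.left)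
      exact ⟨π, hπ, fun h => absurd hn h.ne'⟩
    · obtain ⟨π, hπ, h⟩ := hC n.1 n.2 hn
      exact ⟨π, hπ, fun _ => h⟩
  choose π hπ hle using key
  refine ⟨π, hπ, ?_⟩
  have hlim : Tendsto (fun n : {n : ℕ // TannerEnsembles.Admissible Λ P n} =>
      1 - ENNReal.ofReal (C / n.1)) (comap Subtype.val atTop) (𝓝 1) := by
    have h1 : Tendsto (fun n : ℕ => 1 - ENNReal.ofReal (C / n)) atTop (𝓝 1) := by
      have h2 := ENNReal.tendsto_ofReal (tendsto_const_div_atTop_nhds_zero_nat C)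
      have h3 := ENNReal.Tendsto.sub (tendsto_const_nhds (x := (1 : ℝ≥0∞))) h2
        (Or.inl ENNReal.one_ne_top)
      simpa using h3
    exact h1.comp tendsto_comap
  refine tendsto_of_tendsto_of_tendsto_of_le_of_le' hlim tendsto_const_nhds ?_ ?_
  · have hpos : ∀ᶠ n : {n : ℕ // TannerEnsembles.Admissible Λ P n} in comap Subtype.val atTop,
        0 < n.1 := tendsto_comap.eventually (eventually_gt_atTop 0)
    filter_upwards [hpos] with n hn using hle n hn
  · refine Eventually.of_forall fun n => ?_
    calc (π n).toOuterMeasure _ ≤ (π n).toOuterMeasure Set.univ := measure_mono (Set.subset_univ _)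
      _ = 1 := (PMF.toOuterMeasure_apply_eq_one_iff _ _).2 (Set.subset_univ _)
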